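/- **Setting.** Let $\mathbb F\subseteq\mathbb Z$ be one of $\{0,1,2,\dots\}$, $\{\dots,-1,0\}$, $\mathbb Z$, $\{0,1,\dots,N\}$. A *bandlimit pair* $(\mathbf t,\mathbf t')$ consists of a strictly increasing real sequence $\mathbf t=(t_n)_{n\in\mathbb F}$ without finite accumulation point and a sequence $\mathbf t'=(t_n')_{n\in\mathbb F}$ of positive numbers with $\sum_n t_n'/(1+t_n^2)<\infty$; it is *normalized* if this sum equals $\pi$. Let $(\psi_n)_{n\in\mathbb F}$ be an orthonormal basis of a Hilbert space $\mathcal H$ (inner product conjugate linear in the first argument), let $T_0$ be the self-adjoint operator with $T_0\psi_n=t_n\psi_n$ and maximal domain, and put $$\phi^0_\pm=\sum_n\frac{\sqrt{t_n'}}{t_n\mp i}\,\psi_n,\qquad T=T_0|_{\operatorname{dom}T},\quad \operatorname{dom}T=\{x\in\operatorname{dom}T_0:\langle\phi^0_+,(T_0+i)x\rangle=0\}.$$ *Equal-norm deficiency vectors* for $T$ are non-zero $\phi_+\in\operatorname{ran}(T+i)^\perp$, $\phi_-\in\operatorname{ran}(T-i)^\perp$ with $\|\phi_+\|=\|\phi_-\|$.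 Given these, let $V$ be the partial isometry that maps $(T+i)x$ to $(T-i)x$ for $x\in\operatorname{dom}T$ and vanishes on $\operatorname{ran}(T+i)^\perp$, let $U_\theta=V+e^{2\pi i\theta}\|\phi_+\|^{-2}\langle\phi_+,\cdot\rangle\phi_-$, and let $T_\theta$ be the inverse Cayley transform of $U_\theta$, i.e. $T_\theta(y-U_\theta y)=i(y+U_\theta y)$. A *phase function* of $T$ is a continuous strictly increasing $\tau:\mathbb R\to\mathbb R$ such that for all real $\theta$, $s$: $s$ is an eigenvalue of $T_\theta$ if and only if $\tau(s)\in\theta+\mathbb Z$ (equivalently, $\tau$ is the inverse of the spectral function $n+\theta\mapsto t_n(\theta)$ that lists these eigenvalues in increasing order). The Livšic characteristic function of $T$ is $$\Theta_T(z)=\frac{z-i}{z+i}\,\frac{\langle\phi_z,\phi_+\rangle}{\langle\phi_z,\phi_-\rangle},\qquad \operatorname{Im}z>0,\quad 0\neq\phi_z\in\operatorname{ran}(T-z)^\perp=\ker(T^*-\bar z).$$ The phase function of an inner function $\Phi$ on the upper half-plane with continuous boundary values on $\mathbb R$ is the strictly increasing real-analytic $\gamma:\mathbb R\to\mathbb R$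 with $\gamma'>0$, $\Phi(s)=e^{2\pi i\gamma(s)}$ for $s\in\mathbb R$, and $\gamma(0)\in[0,1)$. Let $F_w(z)=\frac{z-w}{1-z\bar w}$, $g(x)=x\coth x$ for $x>0$, $g(0)=1$, and let $f$ be the inverse of $g:[0,\infty)\to[1,\infty)$. For a normalized pair and fixed equal-norm deficiency vectors, with phase function $\tau$, put $$w=\frac{\pi\tau'(0)-f(\pi\tau'(0))}{\pi\tau'(0)+f(\pi\tau'(0))},\qquad \omega(s)=\pi\gamma'(s)\quad(s\in\mathbb R),$$ where $\gamma$ is the phase function of $F_{-w}\circ\Theta_T$; $\omega$ is the *time-varying bandlimit*. **Proposition.** 1. For every $A>0$, the pair $t_n=n\pi/A$, $t_n'=\frac{\pi}{A}\tanh A$ ($n\in\mathbb Z$) is a normalized bandlimit pair. Its time-varying bandlimit, with respect to the deficiency vectors $\phi^0_\pm$, exists and is the constant function $\omega(s)=A$. 2. The map $g:[0,\infty)\to[1,\infty)$ is a bijection. For every normalized bandlimit pair, $\phi^0_\pm$ are equal-norm deficiency vectors for $T$; and for every choice of equal-norm deficiency vectors a phase function $\tau$ of $T$ exists, and every such $\tau$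 is differentiable at $0$ and satisfies $\pi\tau'(0)\ge1$, so that $w$ is well defined. If the pair has at least two points (i.e. $\mathbb F\ne\{0\}$), then $w\in[0,1)$. -/

import Mathlib

open Filter Topology Complex

noncomputable section

/-! ### Bandlimit pairs -/

/-- The admissible index sets: the non-negative integers, the non-positive integers, all
integers, or `{0, 1, ..., N}`. -/
def IsIndexSet (F : Set ℤ) : Prop :=
  F = Set.Ici 0 ∨ F = Set.Iic 0 ∨ F = Set.univ ∨ ∃ N : ℕ, F = Set.Icc 0 (N : ℤ)

/-- A time-varying bandlimit pair `(t, t')` of real sequences indexed by `F`. -/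
structure IsBandlimitPair (F : Set ℤ) (t t' : F → ℝ) : Prop where
  index : IsIndexSet F
  strictMono : StrictMono t
  noAcc : ∀ x : ℝ, ¬ AccPt x (𝓟 (Set.range t))
  pos : ∀ n, 0 < t' n
  compatible : Summable fun n => t' n / (1 + t n ^ 2)

/-- A bandlimit pair is normalized if `∑ t'ₙ / (1 + tₙ²) = π`. -/
structure IsNormalizedBandlimitPair (F : Set ℤ) (t t' : F → ℝ) : Prop
    extends IsBandlimitPair F t t' where
  normalized : HasSum (fun n => t' n / (1 + t n ^ 2)) Real.pi

/-! ### The symmetric transformation of a bandlimit pair -/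

section Operators

variable {H : Type*} [NormedAddCommGroup H] [InnerProductSpace ℂ H]

/-- The set of all `x` with `∑ |tₙ ⟪ψₙ, x⟫|² < ∞`. -/
def diagDomain {F : Set ℤ} (ψ : HilbertBasis F ℂ H) (t : F → ℝ) : Submodule ℂ H where
  carrier := {x | Memℓp (fun n : F => (t n : ℂ) * ψ.repr x n) 2}
  zero_mem' := by
    have h := zero_memℓp (E := fun _ : F => ℂ) (p := 2)
    have e : (fun n : F => (t n : ℂ) * ψ.repr (0 : H) n) = 0 := by
      funext n; simp
    change Memℓp _ 2
    rw [e]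
    exact h
  add_mem' := by
    intro x y hx hy
    have h := Memℓp.add hx hy
    have e : (fun n : F => (t n : ℂ) * ψ.repr (x + y) n)
        = (fun n : F => (t n : ℂ) * ψ.repr x n) + fun n : F => (t n : ℂ) * ψ.repr y n := by
      funext n; simp [mul_add]
    change Memℓp _ 2
    rw [e]
    exact h
  smul_mem' := by
    intro c x hx
    have h := Memℓp.const_smul hx c
    have e : (fun n : F => (t n : ℂ) * ψ.repr (c • x) n)
        = c • fun n : F => (t n : ℂ) * ψ.repr x n := by
      funext n; simp; ring
    change Memℓp _ 2
    rw [e]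
    exact h

/-- The sequence `tₙ ⟪ψₙ, x⟫` as an element of `ℓ²`. -/
def diagSeq {F : Set ℤ} (ψ : HilbertBasis F ℂ H) (t : F → ℝ) (x : diagDomain ψ t) :
    lp (fun _ : F => ℂ) 2 :=
  ⟨fun n : F => (t n : ℂ) * ψ.repr (x : H) n, x.2⟩

theorem diagSeq_apply {F : Set ℤ} (ψ : HilbertBasis F ℂ H) (t : F → ℝ) (x : diagDomain ψ t)
    (n : F) : diagSeq ψ t x n = (t n : ℂ) * ψ.repr (x : H) n := rfl

/-- The self-adjoint operator with simple eigenvalues `t n` and eigenvectors `ψ n`: it maps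
`x` to `∑ tₙ ⟪ψₙ, x⟫ ψₙ` for `x` in `diagDomain ψ t`. -/
def diagOp {F : Set ℤ} (ψ : HilbertBasis F ℂ H) (t : F → ℝ) : H →ₗ.[ℂ] H where
  domain := diagDomain ψ t
  toFun :=
    { toFun := fun x => ψ.repr.symm (diagSeq ψ t x)
      map_add' := by
        intro x y
        rw [← map_add]
        congr 1
        ext n
        rw [lp.coeFn_add, Pi.add_apply, diagSeq_apply, diagSeq_apply, diagSeq_apply,
          Submodule.coe_add, map_add, lp.coeFn_add, Pi.add_apply, mul_add]
      map_smul' := by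
        intro c x
        rw [RingHom.id_apply, ← map_smul]
        congr 1
        ext n
        rw [lp.coeFn_smul, Pi.smul_apply, diagSeq_apply, diagSeq_apply,
          Submodule.coe_smul, map_smul, lp.coeFn_smul, Pi.smul_apply, smul_eq_mul, smul_eq_mul]
        ring }

/-- The canonical deficiency vector `φ₊ = ∑ √t'ₙ / (tₙ - i) ψₙ`. -/
def phiPlus {F : Set ℤ} (ψ : HilbertBasis F ℂ H) (t t' : F → ℝ) : H :=
  ∑' n : F, ((Real.sqrt (t' n) : ℂ) / ((t n : ℂ) - I)) • ψ n

/-- The canonical deficiency vector `φ₋ = ∑ √t'ₙ / (tₙ + i) ψₙ`. -/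
def phiMinus {F : Set ℤ} (ψ : HilbertBasis F ℂ H) (t t' : F → ℝ) : H :=
  ∑' n : F, ((Real.sqrt (t' n) : ℂ) / ((t n : ℂ) + I)) • ψ n

/-- The domain `{x ∈ dom T₀ | ⟪φ₊, (T₀ + i) x⟫ = 0}`, where `T₀ = diagOp ψ t`. -/
def symmDomain {F : Set ℤ} (ψ : HilbertBasis F ℂ H) (t t' : F → ℝ) : Submodule ℂ H where
  carrier := {x | ∃ h : x ∈ (diagOp ψ t).domain,
    inner ℂ (phiPlus ψ t t') (diagOp ψ t ⟨x, h⟩ + I • x) = 0}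
  zero_mem' := by
    refine ⟨Submodule.zero_mem _, ?_⟩
    have e : (⟨0, Submodule.zero_mem _⟩ : (diagOp ψ t).domain) = 0 := rfl
    rw [e, LinearPMap.map_zero]
    simp
  add_mem' := by
    rintro x y ⟨hx, hx'⟩ ⟨hy, hy'⟩
    refine ⟨Submodule.add_mem _ hx hy, ?_⟩
    have e : (⟨x + y, Submodule.add_mem _ hx hy⟩ : (diagOp ψ t).domain) = ⟨x, hx⟩ + ⟨y, hy⟩ := rfl
    have e2 : diagOp ψ t ⟨x, hx⟩ + diagOp ψ t ⟨y, hy⟩ + I • (x + y)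
        = (diagOp ψ t ⟨x, hx⟩ + I • x) + (diagOp ψ t ⟨y, hy⟩ + I • y) := by
      rw [smul_add]; abel
    rw [e, LinearPMap.map_add, e2, inner_add_right, hx', hy', add_zero]
  smul_mem' := by
    rintro c x ⟨hx, hx'⟩
    refine ⟨Submodule.smul_mem _ c hx, ?_⟩
    have e : (⟨c • x, Submodule.smul_mem _ c hx⟩ : (diagOp ψ t).domain) = c • ⟨x, hx⟩ := rfl
    rw [e, LinearPMap.map_smul, smul_comm I c x, ← smul_add, inner_smul_right, hx', mul_zero]

/-- The symmetric linear transformation `T` of the pair `(t, t')`: the restriction of the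
self-adjoint operator `diagOp ψ t` to `symmDomain ψ t t'`. -/
def symmOp {F : Set ℤ} (ψ : HilbertBasis F ℂ H) (t t' : F → ℝ) : H →ₗ.[ℂ] H :=
  (diagOp ψ t).domRestrict (symmDomain ψ t t')

/-! ### Deficiency vectors and self-adjoint extensions -/

/-- Membership in `ran (T - z)ᗮ`, which is `ker (T* - conj z)`; the adjoint need not be
single-valued, since `T` need not be densely defined. -/
def IsDefect (T : H →ₗ.[ℂ] H) (z : ℂ) (φ : H) : Prop :=
  ∀ x : T.domain, inner ℂ (T x - z • (x : H)) φ = 0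

/-- Non-zero deficiency vectors `φ₊ ∈ ker (T* - i)`, `φ₋ ∈ ker (T* + i)` of equal norm. -/
structure IsDefectPair (T : H →ₗ.[ℂ] H) (φp φm : H) : Prop where
  plus : IsDefect T (-I) φp
  minus : IsDefect T I φm
  norm_eq : ‖φp‖ = ‖φm‖
  ne_zero : φp ≠ 0

/-- The partial isometry `V = b(T)`, `b(z) = (z - i) / (z + i)`, as a relation: it maps
`(T + i) x` to `(T - i) x` for `x ∈ dom T`, and vanishes on `ran (T + i)ᗮ`. -/
def CayleyRel (T : H →ₗ.[ℂ] H) (y u : H) : Prop :=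
  ∃ (x : T.domain) (v : H), IsDefect T (-I) v ∧
    y = (T x + I • (x : H)) + v ∧ u = T x - I • (x : H)

/-- The unitary extension `U(α) = V + α ‖φ₊‖⁻² ⟪φ₊, ·⟫ φ₋` of `V`, as a relation. -/
def UnitaryExtRel (T : H →ₗ.[ℂ] H) (φp φm : H) (α : ℂ) (y u : H) : Prop :=
  ∃ v : H, CayleyRel T y v ∧ u = v + ((α / (‖φp‖ : ℂ) ^ 2) * inner ℂ φp y) • φm

/-- The self-adjoint extension `T(α) = b⁻¹(U(α))`, as a relation: it maps `y - U(α) y` to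
`i (y + U(α) y)`. -/
def SelfAdjExtRel (T : H →ₗ.[ℂ] H) (φp φm : H) (α : ℂ) (x x' : H) : Prop :=
  ∃ y u : H, UnitaryExtRel T φp φm α y u ∧ x = y - u ∧ x' = I • (y + u)

/-- The real number `s` is an eigenvalue of `T(α)`. -/
def IsEigenvalueExt (T : H →ₗ.[ℂ] H) (φp φm : H) (α : ℂ) (s : ℝ) : Prop :=
  ∃ v : H, v ≠ 0 ∧ SelfAdjExtRel T φp φm α v ((s : ℂ) • v)

/-- `τ` is a phase function of `T` (with respect to `φ₊`, `φ₋`): it is continuous and strictly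
increasing, and the eigenvalues of `T_θ = T(exp(2πiθ))` are the points `s` with
`τ(s) ∈ θ + ℤ`. Equivalently, `τ` is the inverse of a spectral function
`n + θ ↦ tₙ(θ)` that lists the eigenvalues of the extensions `T_θ` in increasing order; it is
determined up to an additive integer, which depends on how the eigenvalues are numbered. -/
structure IsPhaseFunctionOfOp (T : H →ₗ.[ℂ] H) (φp φm : H) (τ : ℝ → ℝ) : Prop where
  continuous : Continuous τ
  strictMono : StrictMono τ
  eigenvalue_iff : ∀ θ s : ℝ,
    IsEigenvalueExt T φp φm (exp (2 * Real.pi * I * θ)) s ↔ ∃ k : ℤ, τ s = θ + k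

open Classical in
/-- The Livšic characteristic function
`Θ_T(z) = (z - i) / (z + i) * ⟪φ_z, φ₊⟫ / ⟪φ_z, φ₋⟫` on the upper half-plane, where `φ_z` is
any non-zero element of `ran (T - z)ᗮ = ker (T* - conj z)`; the inner product is conjugate
linear in the first argument. -/
def livsic (T : H →ₗ.[ℂ] H) (φp φm : H) (z : ℂ) : ℂ :=
  if h : ∃ φ : H, IsDefect T z φ ∧ φ ≠ 0 then
    (z - I) / (z + I) * (inner ℂ h.choose φp / inner ℂ h.choose φm)
  else 0

end Operators

/-! ### The time-varying bandlimit -/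

/-- The Möbius transformation `F_w(z) = (z - w) / (1 - z conj w)` of the unit disk. -/
def moebius (w z : ℂ) : ℂ := (z - w) / (1 - z * (starRingEnd ℂ) w)

/-- `γ` is the phase function of the inner function `Φ` on the upper half-plane: it is strictly
increasing and real analytic with positive derivative, `Φ(t) = exp(2πiγ(t))` for the boundary
values of `Φ` on the real line, and `γ(0) ∈ [0, 1)`. -/
structure IsPhaseFunction (Φ : ℂ → ℂ) (γ : ℝ → ℝ) : Prop where
  strictMono : StrictMono γ
  analytic : AnalyticOnNhd ℝ γ Set.univ
  deriv_pos : ∀ s, 0 < deriv γ s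
  boundary : ∀ s : ℝ, Tendsto Φ (𝓝[{z : ℂ | 0 < z.im}] (s : ℂ))
    (𝓝 (exp (2 * Real.pi * I * γ s)))
  init : γ 0 ∈ Set.Ico (0 : ℝ) 1

/-- The function `g(x) = x coth x`, with `g(0) = 1`. -/
def xCoth (x : ℝ) : ℝ := if x = 0 then 1 else x * (Real.cosh x / Real.sinh x)

/-- The inverse `f : [1, ∞) → [0, ∞)` of `g : [0, ∞) → [1, ∞)`. -/
def xCothInv : ℝ → ℝ := Function.invFunOn xCoth (Set.Ici 0)

/-- The parameter `w = (πτ'(0) - f(πτ'(0))) / (πτ'(0) + f(πτ'(0)))`. -/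
def bandParam (τ : ℝ → ℝ) : ℝ :=
  (Real.pi * deriv τ 0 - xCothInv (Real.pi * deriv τ 0)) /
    (Real.pi * deriv τ 0 + xCothInv (Real.pi * deriv τ 0))

/-- `ω` is the time-varying bandlimit of `T` with respect to `φ₊`, `φ₋`: `ω = πγ'`, where `γ` is
the phase function of `F_{-w} ∘ Θ_T`. -/
def IsTimeVaryingBandlimit {H : Type*} [NormedAddCommGroup H] [InnerProductSpace ℂ H]
    (T : H →ₗ.[ℂ] H) (φp φm : H) (ω : ℝ → ℝ) : Prop :=
  ∃ τ γ : ℝ → ℝ, IsPhaseFunctionOfOp T φp φm τ ∧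
    IsPhaseFunction (fun z => moebius (-(bandParam τ : ℂ)) (livsic T φp φm z)) γ ∧
    ∀ s, ω s = Real.pi * deriv γ s

/-- The Paley-Wiener sampling points `tₙ = nπ/A`, `n ∈ ℤ`. -/
def pwT (A : ℝ) : ↥(Set.univ : Set ℤ) → ℝ := fun n => ((n : ℤ) : ℝ) * Real.pi / A

/-- The Paley-Wiener weights `t'ₙ = (π/A) tanh A`, `n ∈ ℤ`. -/
def pwT' (A : ℝ) : ↥(Set.univ : Set ℤ) → ℝ := fun _ => Real.pi / A * Real.tanh A

end

noncomputable section

/-! ### The function `x coth x` -/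

/-! Everything is reduced to one scalar function. For a normalized pair the weights μₙ =
t'ₙ/(π(1+tₙ²)) form a discrete probability measure; let G(z) = ∑ μₙ/(z−tₙ) and X(z) = −z +
(1+z²)G(z). In the basis ψ the domain condition on x becomes ∑ √t'ₙ xₙ = 0, so for Im z ≠ 0 the
space ran(T−z)ᗮ is spanned by the vector with coordinates √t'ₙ/(tₙ−z̄). Its inner products with φ⁰₊
and φ⁰₋ are multiples of 1−(z+i)G and 1−(z−i)G (`inner_kernel`). Hence Θ_T = (X+i)/(X−i), and s is
an eigenvalue of T(α) exactly when α is a unimodular constant times the boundary value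
(X(s)+i)/(X(s)−i), read as 1 at the poles tₙ (`isEigenvalueExt_iff`).

This curve on the circle is real analytic with positive angular speed, so it lifts to a phase τ,
unique up to an integer. At 0 its speed gives πτ'(0) = (1+∑μₙ/tₙ²)/(1+G(0)²), or 1/μₘ if tₘ = 0. The
first is at least 1 by Cauchy–Schwarz, the second because μₘ ≤ 1; both are strict once there are two
points. Since g is increasing with g(0) = 1 and g(x) > x, it follows that 0 < f(πτ'(0)) < πτ'(0),
which places w in [0,1).

For the Paley–Wiener pair the cotangent series gives both the normalization and X(z) = tanh A ·
cot(Az). With E = exp(2iAz) and ρ = exp(−2A) this says Θ_T = F_ρ(E). Moreover πτ'(0) = 1/μ₀ = A coth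
A = g(A), so w = ρ, and F_{−w} undoes F_ρ. The result exp(2iAz) has phase As/π, whence ω = A. -/

theorem sinh_div_self_eq_dslope {x : ℝ} (hx : x ≠ 0) :
    Real.sinh x / x = dslope Real.sinh 0 x := by
  rw [dslope_of_ne _ hx, slope_def_field]; simp

/-- The divided slope of sinh at 0 absorbs the removable singularity, so continuity of g at 0 needs
no separate limit. -/
theorem xCoth_eq_cosh_div_dslope (x : ℝ) : xCoth x = Real.cosh x / dslope Real.sinh 0 x := by
  unfold xCoth
  split_ifs with h
  · subst h; simp [dslope_same]
  · rw [← sinh_div_self_eq_dslope h]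
    have : Real.sinh x ≠ 0 := by simpa using h
    field_simp

theorem dslope_sinh_pos (x : ℝ) : 0 < dslope Real.sinh 0 x := by
  rcases lt_trichotomy x 0 with h | h | h
  · rw [← sinh_div_self_eq_dslope h.ne]
    exact div_pos_of_neg_of_neg (Real.sinh_neg_iff.2 h) h
  · subst h; simp [dslope_same]
  · rw [← sinh_div_self_eq_dslope h.ne']
    exact div_pos (Real.sinh_pos_iff.2 h) h

theorem continuous_xCoth : Continuous xCoth := by
  have h1 : Continuous (dslope Real.sinh 0) := by
    rw [← continuousOn_univ, continuousOn_dslope univ_mem]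
    exact ⟨Real.continuous_sinh.continuousOn, Real.differentiable_sinh 0⟩
  have h2 : xCoth = fun x => Real.cosh x / dslope Real.sinh 0 x :=
    funext xCoth_eq_cosh_div_dslope
  rw [h2]
  exact Real.continuous_cosh.div h1 fun x => (dslope_sinh_pos x).ne'

theorem xCoth_zero : xCoth 0 = 1 := by simp [xCoth]

theorem xCoth_of_pos {x : ℝ} (hx : 0 < x) : xCoth x = x * (Real.cosh x / Real.sinh x) := by
  simp [xCoth, hx.ne']

/-- On (0, ∞) the derivative is (cosh x sinh x − x)/sinh² x, positive because sinh x > x and cosh x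
≥ 1. -/
theorem strictMonoOn_xCoth : StrictMonoOn xCoth (Set.Ici 0) := by
  refine strictMonoOn_of_deriv_pos (convex_Ici 0) continuous_xCoth.continuousOn ?_
  intro x hx
  rw [interior_Ici] at hx
  have hx : 0 < x := hx
  have hs : 0 < Real.sinh x := Real.sinh_pos_iff.2 hx
  have hd : HasDerivAt (fun y => y * (Real.cosh y / Real.sinh y))
      (1 * (Real.cosh x / Real.sinh x) + x * ((Real.sinh x * Real.sinh x
        - Real.cosh x * Real.cosh x) / Real.sinh x ^ 2)) x :=
    (hasDerivAt_id x).mul ((Real.hasDerivAt_cosh x).div (Real.hasDerivAt_sinh x) hs.ne')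
  have he : xCoth =ᶠ[𝓝 x] fun y => y * (Real.cosh y / Real.sinh y) := by
    filter_upwards [lt_mem_nhds hx] with y hy using xCoth_of_pos hy
  rw [he.deriv_eq, hd.deriv]
  have hsq := Real.cosh_sq x
  have hlt : x < Real.sinh x := Real.self_lt_sinh_iff.2 hx
  have hc : 1 ≤ Real.cosh x := Real.one_le_cosh x
  have : 1 * (Real.cosh x / Real.sinh x) + x * ((Real.sinh x * Real.sinh x
        - Real.cosh x * Real.cosh x) / Real.sinh x ^ 2)
      = (Real.cosh x * Real.sinh x - x) / Real.sinh x ^ 2 := by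
    field_simp
    rw [hsq]; ring
  rw [this]
  apply div_pos _ (by positivity)
  nlinarith

/-- This holds because coth > 1. It supplies the upper endpoint for the intermediate value argument
below, and f(P) < P in the bound w ≥ 0. -/
theorem self_lt_xCoth {x : ℝ} (hx : 0 ≤ x) : x < xCoth x := by
  rcases hx.eq_or_lt with rfl | hx
  · simp [xCoth_zero]
  · rw [xCoth_of_pos hx]
    have hs : 0 < Real.sinh x := Real.sinh_pos_iff.2 hx
    have : 1 < Real.cosh x / Real.sinh x := (one_lt_div hs).2 (Real.sinh_lt_cosh x)
    nlinarith

theorem bijOn_xCoth : Set.BijOn xCoth (Set.Ici 0) (Set.Ici 1) := by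
  refine ⟨fun x hx => ?_, strictMonoOn_xCoth.injOn, fun y hy => ?_⟩
  · have := strictMonoOn_xCoth.monotoneOn (Set.mem_Ici.2 le_rfl) hx hx
    rwa [xCoth_zero] at this
  · have hy : 1 ≤ y := hy
    have hy0 : 0 ≤ y := by linarith
    obtain ⟨x, hx, rfl⟩ := intermediate_value_Icc hy0 continuous_xCoth.continuousOn
      (show y ∈ Set.Icc (xCoth 0) (xCoth y) from
        ⟨by rwa [xCoth_zero], (self_lt_xCoth hy0).le⟩)
    exact ⟨x, hx.1, rfl⟩

theorem xCothInv_xCoth {x : ℝ} (hx : 0 ≤ x) : xCothInv (xCoth x) = x :=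
  strictMonoOn_xCoth.injOn.leftInvOn_invFunOn hx

theorem xCothInv_nonneg {y : ℝ} (hy : 1 ≤ y) : 0 ≤ xCothInv y :=
  Function.invFunOn_mem (bijOn_xCoth.surjOn hy)

theorem xCoth_xCothInv {y : ℝ} (hy : 1 ≤ y) : xCoth (xCothInv y) = y :=
  Function.invFunOn_eq (bijOn_xCoth.surjOn hy)

theorem bandParam_mem_Ico {τ : ℝ → ℝ} (h : 1 < Real.pi * deriv τ 0) :
    bandParam τ ∈ Set.Ico (0 : ℝ) 1 := by
  unfold bandParam
  set P := Real.pi * deriv τ 0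
  have h0 := xCothInv_nonneg h.le
  have h1 := xCoth_xCothInv h.le
  have hne : xCothInv P ≠ 0 := by
    intro h2
    rw [h2, xCoth_zero] at h1
    linarith
  have hpos : 0 < xCothInv P := lt_of_le_of_ne h0 hne.symm
  have hlt := self_lt_xCoth h0
  rw [h1] at hlt
  refine ⟨div_nonneg (by linarith) (by linarith), ?_⟩
  rw [div_lt_one (by linarith)]
  linarith

/-! ### Lifting a curve on the circle -/

/-- Two continuous real functions with the same image under `x ↦ exp (2πix)` differ by an integer
constant. -/
theorem exists_int_forall_eq_add_of_exp_eq {f g : ℝ → ℝ} (hf : Continuous f) (hg : Continuous g)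
    (h : ∀ s, exp (2 * Real.pi * I * f s) = exp (2 * Real.pi * I * g s)) :
    ∃ k : ℤ, ∀ s, f s = g s + k := by
  have key : ∀ s, ∃ k : ℤ, f s - g s = k := by
    intro s
    obtain ⟨k, hk⟩ := Complex.exp_eq_exp_iff_exists_int.1 (h s)
    refine ⟨k, ?_⟩
    have h2 : (2 * Real.pi * I : ℂ) ≠ 0 := Complex.two_pi_I_ne_zero
    have h3 : (2 * Real.pi * I : ℂ) * (f s) = (2 * Real.pi * I) * (g s + k) := by rw [hk]; ring
    have h4 := mul_left_cancel₀ h2 h3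
    have h5 : f s = g s + k := by exact_mod_cast h4
    linarith
  choose k hk using key
  -- The difference is continuous and integer-valued, hence constant on the connected line.
  have hc : Continuous k := by
    rw [Int.isClosedEmbedding_coe_real.isInducing.continuous_iff]
    exact (hf.sub hg).congr hk
  refine ⟨k 0, fun s => ?_⟩
  have h1 := hk s
  rw [PreconnectedSpace.constant (inferInstance : PreconnectedSpace ℝ) hc (x := s) (y := 0)] at h1
  linarith

/-- A curve on the circle that satisfies `α' = 2πi κ α` with continuous `κ` has a phase with
derivative `κ`. -/
theorem exists_phase {α : ℝ → ℂ} {κ : ℝ → ℝ} (hκ : Continuous κ)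
    (hα : ∀ s, HasDerivAt α (2 * Real.pi * I * κ s * α s) s) (h0 : ‖α 0‖ = 1) :
    ∃ τ : ℝ → ℝ, (∀ s, HasDerivAt τ (κ s) s) ∧ ∀ s, exp (2 * Real.pi * I * τ s) = α s := by
  obtain ⟨c, hc⟩ : ∃ c : ℝ, exp (2 * Real.pi * I * c) = α 0 := by
    refine ⟨(α 0).arg / (2 * Real.pi), ?_⟩
    have h := Complex.norm_mul_exp_arg_mul_I (α 0)
    rw [h0] at h
    rw [ofReal_one, one_mul] at h
    refine Eq.trans ?_ h
    push_cast
    congr 1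
    have : (Real.pi : ℂ) ≠ 0 := by exact_mod_cast Real.pi_ne_zero
    field_simp
  set τ : ℝ → ℝ := fun s => c + ∫ x in (0 : ℝ)..s, κ x
  have hτ : ∀ s, HasDerivAt τ (κ s) s := fun s =>
    (intervalIntegral.integral_hasDerivAt_right (hκ.intervalIntegrable _ _)
      (hκ.stronglyMeasurableAtFilter _ _) hκ.continuousAt).const_add c
  refine ⟨τ, hτ, fun s => ?_⟩
  -- Integrating factor: the quotient of the curve by its candidate lift has derivative zero.
  set F : ℝ → ℂ := fun s => exp (-(2 * Real.pi * I * τ s)) * α s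
  have hF : ∀ s, HasDerivAt F 0 s := by
    intro s
    have h1 : HasDerivAt (fun s : ℝ => -(2 * Real.pi * I * (τ s : ℂ)))
        (-(2 * Real.pi * I * (κ s : ℂ))) s :=
      ((hτ s).ofReal_comp.const_mul _).neg
    have h2 := h1.cexp.mul (hα s)
    exact h2.congr_deriv (by ring)
  have h1 : F s = F 0 := is_const_of_deriv_eq_zero (fun s => (hF s).differentiableAt)
    (fun s => (hF s).deriv) s 0
  have h2 : F 0 = 1 := by
    have : τ 0 = c := by simp [τ]
    simp only [F, this, ← hc]
    rw [← Complex.exp_add]; simp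
  rw [h2] at h1
  have h3 : exp (2 * Real.pi * I * τ s) * F s = α s := by
    simp only [F]
    rw [← mul_assoc, ← Complex.exp_add]; simp
  rw [← h3, h1, mul_one]

/-! ### Cauchy sums -/

/-- The Cauchy transform `∑ μₙ / (z - tₙ)` of a discrete measure. -/
def cauchySum {ι : Type*} (μ t : ι → ℝ) (z : ℂ) : ℂ := ∑' n, (μ n : ℂ) / (z - t n)

/-- The restriction of `cauchySum` to the real line. -/
def realCauchySum {ι : Type*} (μ t : ι → ℝ) (s : ℝ) : ℝ := ∑' n, μ n / (s - t n)

theorem cauchySum_ofReal {ι : Type*} (μ t : ι → ℝ) (s : ℝ) :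
    cauchySum μ t s = realCauchySum μ t s := by
  simp [cauchySum, realCauchySum, Complex.ofReal_tsum]

/-- The lower bound is required only where μ does not vanish, so that a Cauchy sum can be evaluated
at a pole whose mass has been removed. -/
theorem summable_div_of_le {ι : Type*} {μ : ι → ℝ} (hμ : Summable μ) (hμ0 : ∀ n, 0 ≤ μ n)
    {δ : ℝ} (hδ : 0 < δ) {c : ι → ℂ} (h : ∀ n, μ n ≠ 0 → δ ≤ ‖c n‖) :
    Summable fun n => (μ n : ℂ) / c n := by
  refine Summable.of_norm_bounded (hμ.mul_left δ⁻¹) fun n => ?_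
  by_cases hn : μ n = 0
  · simp [hn]
  · rw [norm_div, Complex.norm_real, Real.norm_of_nonneg (hμ0 n), inv_mul_eq_div]
    exact div_le_div_of_nonneg_left (hμ0 n) hδ (h n hn)

section

variable {ι : Type*} {μ t : ι → ℝ} (hμ : Summable μ) (hμ0 : ∀ n, 0 ≤ μ n) {s δ : ℝ} (hδ : 0 < δ)
  (h : ∀ n, μ n ≠ 0 → δ ≤ |s - t n|)

include hμ hμ0 hδ h

/-- On the disc of radius δ/2 about s every denominator that matters is at least δ/2, so the series
is dominated by (2/δ)μₙ. Weierstrass' theorem gives holomorphy and termwise differentiation. -/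
theorem cauchySum_analyticAt_hasDerivAt :
    AnalyticAt ℂ (cauchySum μ t) s ∧
      HasDerivAt (cauchySum μ t) (∑' n, -(μ n : ℂ) / (s - t n) ^ 2) s := by
  have hfar : ∀ n, μ n ≠ 0 → ∀ w ∈ Metric.ball (s : ℂ) (δ / 2), δ / 2 ≤ ‖w - t n‖ := by
    intro n hn w hw
    rw [mem_ball_iff_norm] at hw
    have h1 := h n hn
    have h2 : ‖(s : ℂ) - t n‖ = |s - t n| := by
      rw [← Complex.ofReal_sub, Complex.norm_real, Real.norm_eq_abs]
    have h3 : ‖(s : ℂ) - t n‖ ≤ ‖w - t n‖ + ‖w - s‖ := by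
      have : (s : ℂ) - t n = (w - t n) - (w - s) := by ring
      rw [this]; exact norm_sub_le _ _
    linarith
  have hu : Summable fun n => (δ / 2)⁻¹ * μ n := hμ.mul_left _
  have hd : ∀ n, ∀ w ∈ Metric.ball (s : ℂ) (δ / 2),
      HasDerivAt (fun w : ℂ => (μ n : ℂ) / (w - t n)) (-(μ n : ℂ) / (w - t n) ^ 2) w := by
    intro n w hw
    by_cases hn : μ n = 0
    · simpa [hn] using hasDerivAt_const w (0 : ℂ)
    · have hne : w - t n ≠ 0 := by
        rw [← norm_pos_iff]; linarith [hfar n hn w hw]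
      exact ((hasDerivAt_const w (μ n : ℂ)).div ((hasDerivAt_id w).sub_const (t n : ℂ))
        hne).congr_deriv (by simp)
  have hdo : ∀ n, DifferentiableOn ℂ (fun w : ℂ => (μ n : ℂ) / (w - t n))
      (Metric.ball (s : ℂ) (δ / 2)) := fun n w hw =>
    (hd n w hw).differentiableAt.differentiableWithinAt
  have hle : ∀ n, ∀ w ∈ Metric.ball (s : ℂ) (δ / 2),
      ‖(μ n : ℂ) / (w - t n)‖ ≤ (δ / 2)⁻¹ * μ n := by
    intro n w hw
    by_cases hn : μ n = 0
    · simp [hn]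
    · rw [norm_div, Complex.norm_real, Real.norm_of_nonneg (hμ0 n), inv_mul_eq_div]
      exact div_le_div_of_nonneg_left (hμ0 n) (by positivity) (hfar n hn w hw)
  have hs : (s : ℂ) ∈ Metric.ball (s : ℂ) (δ / 2) := Metric.mem_ball_self (by positivity)
  have hdiff : DifferentiableOn ℂ (cauchySum μ t) (Metric.ball (s : ℂ) (δ / 2)) :=
    Complex.differentiableOn_tsum_of_summable_norm hu hdo Metric.isOpen_ball hle
  have hnhds := Metric.isOpen_ball.mem_nhds hs
  refine ⟨hdiff.analyticAt hnhds, ?_⟩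
  have hsum := Complex.hasSum_deriv_of_summable_norm hu hdo Metric.isOpen_ball hle hs
  have heq : ∑' n, -(μ n : ℂ) / (s - t n) ^ 2 = deriv (cauchySum μ t) s := by
    rw [show cauchySum μ t = fun w => ∑' n, (μ n : ℂ) / (w - t n) from rfl, ← hsum.tsum_eq]
    exact tsum_congr fun n => ((hd n s hs).deriv).symm
  rw [heq]
  exact (hdiff.differentiableAt hnhds).hasDerivAt

theorem analyticAt_realCauchySum : AnalyticAt ℝ (realCauchySum μ t) s := by
  have h1 := (cauchySum_analyticAt_hasDerivAt hμ hμ0 hδ h).1.restrictScalars (𝕜 := ℝ)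
  have h2 : AnalyticAt ℝ (fun x : ℝ => cauchySum μ t (ofRealCLM x)) s :=
    AnalyticAt.comp (f := fun x : ℝ => ofRealCLM x) h1 (ofRealCLM.analyticAt s)
  have h3 := (Complex.reCLM.analyticAt _).comp h2
  convert h3 using 1
  funext x
  simp [cauchySum_ofReal]

theorem hasDerivAt_realCauchySum :
    HasDerivAt (realCauchySum μ t) (-∑' n, μ n / (s - t n) ^ 2) s := by
  have h1 := (cauchySum_analyticAt_hasDerivAt hμ hμ0 hδ h).2.real_of_complex
  convert h1 using 1
  · funext x
    rw [cauchySum_ofReal, ofReal_re]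
  · have : ∑' n, -(μ n : ℂ) / (s - t n) ^ 2 = ((-∑' n, μ n / (s - t n) ^ 2 : ℝ) : ℂ) := by
      push_cast
      rw [← tsum_neg]
      exact tsum_congr fun n => by rw [neg_div]
    rw [this, ofReal_re]

end

/-! ### The spectral curve of a discrete probability measure -/

theorem exists_pos_le_abs_sub_of_not_accPt {ι : Type*} {t : ι → ℝ} {s : ℝ}
    (h : ¬ AccPt s (𝓟 (Set.range t))) : ∃ δ > 0, ∀ n, t n ≠ s → δ ≤ |s - t n| := by
  rw [accPt_iff_frequently, not_frequently, Metric.eventually_nhds_iff] at h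
  obtain ⟨δ, hδ, h⟩ := h
  refine ⟨δ, hδ, fun n hn => ?_⟩
  by_contra hlt
  push Not at hlt
  exact h (y := t n) (by rwa [dist_comm, Real.dist_eq]) ⟨hn, n, rfl⟩

/-- The curve is exp(2i·arg(q+ip)), whose angular speed is 2(qp'−q'p)/(p²+q²). Homogeneous
coordinates q/p for X treat regular points (p = 1) and poles (p = x−tₘ) alike. -/
theorem analyticAt_hasDerivAt_of_eventuallyEq_ratio {α : ℝ → ℂ} {p q : ℝ → ℝ} {p' q' s : ℝ}
    (hp : AnalyticAt ℝ p s) (hq : AnalyticAt ℝ q s) (hp' : HasDerivAt p p' s)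
    (hq' : HasDerivAt q q' s) (hne : p s ≠ 0 ∨ q s ≠ 0)
    (hα : α =ᶠ[𝓝 s] fun x => ((q x : ℂ) + I * p x) / (q x - I * p x)) :
    AnalyticAt ℝ α s ∧
      HasDerivAt α (2 * Real.pi * I * ((q s * p' - q' * p s) / (p s ^ 2 + q s ^ 2) / Real.pi : ℝ)
        * α s) s := by
  have hden : (q s : ℂ) - I * p s ≠ 0 := by
    intro h0
    have hre := congrArg Complex.re h0
    have him := congrArg Complex.im h0
    simp at hre him
    tauto
  have hden2 : (q s : ℂ) + I * p s ≠ 0 := by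
    intro h0
    have hre := congrArg Complex.re h0
    have him := congrArg Complex.im h0
    simp at hre him
    tauto
  have hP : AnalyticAt ℝ (fun x => (p x : ℂ)) s := (ofRealCLM.analyticAt _).comp hp
  have hQ : AnalyticAt ℝ (fun x => (q x : ℂ)) s := (ofRealCLM.analyticAt _).comp hq
  constructor
  · have h1 : AnalyticAt ℝ (fun x => ((q x : ℂ) + I * p x) / (q x - I * p x)) s :=
      (hQ.add (analyticAt_const.mul hP)).div (hQ.sub (analyticAt_const.mul hP)) hden
    exact h1.congr hα.symm
  · rw [hα.self_of_nhds]
    have h1 : HasDerivAt (fun x => ((q x : ℂ) + I * p x) / (q x - I * p x)) _ s :=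
      (hq'.ofReal_comp.add (hp'.ofReal_comp.const_mul I)).div
        (hq'.ofReal_comp.sub (hp'.ofReal_comp.const_mul I)) hden
    refine (h1.congr_of_eventuallyEq hα).congr_deriv ?_
    have hpi : (Real.pi : ℂ) ≠ 0 := by exact_mod_cast Real.pi_ne_zero
    have hfac : ((p s : ℂ) ^ 2 + (q s : ℂ) ^ 2) = (q s + I * p s) * (q s - I * p s) := by
      linear_combination (p s : ℂ) ^ 2 * I_sq
    push_cast
    rw [hfac]
    simp only [Pi.add_apply]
    field_simp
    ring

/-- The real function `-s + (1 + s²) ∑ μₙ / (s - tₙ)`. -/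
def nevanlinna {ι : Type*} (μ t : ι → ℝ) (s : ℝ) : ℝ := -s + (1 + s ^ 2) * realCauchySum μ t s

open Classical in
/-- The curve on the circle that passes through `1` exactly at the points `tₙ`. -/
def spectralCurve {ι : Type*} (μ t : ι → ℝ) (s : ℝ) : ℂ :=
  if s ∈ Set.range t then 1 else ((nevanlinna μ t s : ℂ) + I) / (nevanlinna μ t s - I)

theorem ofReal_sub_I_ne_zero (x : ℝ) : (x : ℂ) - I ≠ 0 := by
  intro h
  have := congrArg Complex.im h
  simp at this

theorem ofReal_add_I_ne_zero (x : ℝ) : (x : ℂ) + I ≠ 0 := by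
  intro h
  have := congrArg Complex.im h
  simp at this

theorem norm_spectralCurve {ι : Type*} (μ t : ι → ℝ) (s : ℝ) : ‖spectralCurve μ t s‖ = 1 := by
  unfold spectralCurve
  split_ifs
  · simp
  · rw [norm_div]
    have : ‖(nevanlinna μ t s : ℂ) + I‖ = ‖(nevanlinna μ t s : ℂ) - I‖ := by
      rw [← Complex.norm_conj]
      simp [sub_eq_add_neg]
    rw [this, div_self]
    exact norm_ne_zero_iff.2 (ofReal_sub_I_ne_zero _)

/-- A discrete probability measure on the real line, with masses `μ n` at distinct points `t n`
that do not accumulate. -/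
structure IsDiscreteProb {ι : Type*} (μ t : ι → ℝ) : Prop where
  hasSum : HasSum μ 1
  pos : ∀ n, 0 < μ n
  injective : Function.Injective t
  noAcc : ∀ x : ℝ, ¬ AccPt x (𝓟 (Set.range t))

namespace IsDiscreteProb

variable {ι : Type*} {μ t : ι → ℝ} (h : IsDiscreteProb μ t)

include h

theorem exists_gap {s : ℝ} (hs : s ∉ Set.range t) : ∃ δ > 0, ∀ n, δ ≤ |s - t n| := by
  obtain ⟨δ, hδ, H⟩ := exists_pos_le_abs_sub_of_not_accPt (h.noAcc s)
  exact ⟨δ, hδ, fun n => H n fun e => hs ⟨n, e⟩⟩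

theorem lt_one_of_ne {m n : ι} (hmn : m ≠ n) : μ m < 1 := by
  have h1 : μ m + μ n ≤ 1 := by
    classical
    have := sum_le_hasSum {m, n} (fun i _ => (h.pos i).le) h.hasSum
    rwa [Finset.sum_pair hmn] at this
  linarith [h.pos n]

theorem le_one (m : ι) : μ m ≤ 1 :=
  le_hasSum h.hasSum m fun i _ => (h.pos i).le

theorem summable_div {s : ℝ} (hs : s ∉ Set.range t) : Summable fun n => μ n / (s - t n) := by
  obtain ⟨δ, hδ, H⟩ := h.exists_gap hs
  have := summable_div_of_le (c := fun n => ((s - t n : ℝ) : ℂ)) h.hasSum.summable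
    (fun n => (h.pos n).le) hδ (fun n _ => by
      rw [Complex.norm_real, Real.norm_eq_abs]; exact H n)
  exact_mod_cast this

theorem summable_div_sq {s : ℝ} (hs : s ∉ Set.range t) :
    Summable fun n => μ n / (s - t n) ^ 2 := by
  obtain ⟨δ, hδ, H⟩ := h.exists_gap hs
  have := summable_div_of_le (c := fun n => (((s - t n) ^ 2 : ℝ) : ℂ)) h.hasSum.summable
    (fun n => (h.pos n).le) (pow_pos hδ 2) (fun n _ => by
      rw [Complex.norm_real, Real.norm_eq_abs, abs_pow]
      exact pow_le_pow_left₀ hδ.le (H n) 2)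
  exact_mod_cast this

/-- The variance of 1/(s−t) under the probability measure, expanded with total mass 1. Its
nonnegativity is the Cauchy–Schwarz bound behind πτ'(0) ≥ 1. -/
theorem hasSum_variance {s : ℝ} (hs : s ∉ Set.range t) :
    HasSum (fun n => μ n * (1 / (s - t n) - realCauchySum μ t s) ^ 2)
      ((∑' n, μ n / (s - t n) ^ 2) - realCauchySum μ t s ^ 2) := by
  have h1 := (h.summable_div hs).hasSum
  have h2 := (h.summable_div_sq hs).hasSum
  set G := realCauchySum μ t s with hG
  have h3 := (h2.sub (h1.mul_left (2 * G))).add (h.hasSum.mul_left (G ^ 2))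
  have hG' : ∑' n, μ n / (s - t n) = G := rfl
  rw [hG'] at h3
  rw [show (∑' n, μ n / (s - t n) ^ 2) - G ^ 2
    = ∑' n, μ n / (s - t n) ^ 2 - 2 * G * G + G ^ 2 * 1 by ring]
  refine h3.congr_fun fun n => ?_
  have : s - t n ≠ 0 := sub_ne_zero.2 fun e => hs ⟨n, e.symm⟩
  field_simp
  ring

theorem sq_realCauchySum_le {s : ℝ} (hs : s ∉ Set.range t) :
    realCauchySum μ t s ^ 2 ≤ ∑' n, μ n / (s - t n) ^ 2 := by
  have := (h.hasSum_variance hs).nonneg fun n => mul_nonneg (h.pos n).le (sq_nonneg _)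
  linarith

theorem sq_realCauchySum_lt {s : ℝ} (hs : s ∉ Set.range t) {m n : ι} (hmn : m ≠ n) :
    realCauchySum μ t s ^ 2 < ∑' n, μ n / (s - t n) ^ 2 := by
  have hnonneg : ∀ n, 0 ≤ μ n * (1 / (s - t n) - realCauchySum μ t s) ^ 2 := fun n =>
    mul_nonneg (h.pos n).le (sq_nonneg _)
  -- Zero variance would make all the points tₖ equal, contrary to injectivity at m ≠ n.
  obtain ⟨k, hk⟩ : ∃ k, 1 / (s - t k) ≠ realCauchySum μ t s := by
    by_contra! H
    have e := (H m).trans (H n).symm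
    rw [one_div, one_div, inv_inj, sub_right_inj] at e
    exact hmn (h.injective e)
  have h1 := le_hasSum (h.hasSum_variance hs) k fun i _ => hnonneg i
  have h2 : 0 < μ k * (1 / (s - t k) - realCauchySum μ t s) ^ 2 :=
    mul_pos (h.pos k) (by have := sub_ne_zero.2 hk; positivity)
  linarith

theorem nonempty : Nonempty ι := by
  by_contra hne
  rw [not_nonempty_iff] at hne
  exact one_ne_zero (h.hasSum.unique hasSum_empty)

theorem tsum_div_sq_pos {s : ℝ} (hs : s ∉ Set.range t) : 0 < ∑' n, μ n / (s - t n) ^ 2 := by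
  obtain ⟨m⟩ := h.nonempty
  have hpos : ∀ n, 0 < μ n / (s - t n) ^ 2 := fun n => by
    have : s - t n ≠ 0 := sub_ne_zero.2 fun e => hs ⟨n, e.symm⟩
    have := h.pos n
    positivity
  exact (h.summable_div_sq hs).tsum_pos (fun n => (hpos n).le) m (hpos m)

theorem eventually_notMem_range (s : ℝ) : ∀ᶠ x in 𝓝[≠] s, x ∉ Set.range t := by
  have := h.noAcc s
  rw [accPt_iff_frequently_nhdsNE, not_frequently] at this
  exact this

theorem spectralCurve_of_notMem {s : ℝ} (hs : s ∉ Set.range t) :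
    AnalyticAt ℝ (spectralCurve μ t) s ∧
      HasDerivAt (spectralCurve μ t) (2 * Real.pi * I *
        ((1 - 2 * s * realCauchySum μ t s + (1 + s ^ 2) * ∑' n, μ n / (s - t n) ^ 2) /
          (1 + nevanlinna μ t s ^ 2) / Real.pi : ℝ) * spectralCurve μ t s) s := by
  obtain ⟨δ, hδ, H⟩ := h.exists_gap hs
  have hA := analyticAt_realCauchySum h.hasSum.summable (fun n => (h.pos n).le) hδ fun n _ => H n
  have hD := hasDerivAt_realCauchySum h.hasSum.summable (fun n => (h.pos n).le) hδ fun n _ => H n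
  have hN : AnalyticAt ℝ (nevanlinna μ t) s :=
    analyticAt_id.neg.add ((analyticAt_const.add (analyticAt_id.pow 2)).mul hA)
  have hN' : HasDerivAt (nevanlinna μ t) (-1 + ((2 * s) * realCauchySum μ t s
      + (1 + s ^ 2) * -∑' n, μ n / (s - t n) ^ 2)) s := by
    have h1 : HasDerivAt (fun x : ℝ => 1 + x ^ 2) (2 * s) s := by
      simpa using (hasDerivAt_pow 2 s).const_add 1
    exact (hasDerivAt_id s).neg.add (h1.mul hD)
  have hev : ∀ᶠ x in 𝓝 s, x ∉ Set.range t := by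
    have := h.eventually_notMem_range s
    rw [eventually_nhdsWithin_iff] at this
    filter_upwards [this] with x hx
    by_cases e : x = s
    · rwa [e]
    · exact hx e
  have hα : spectralCurve μ t =ᶠ[𝓝 s]
      fun x => ((nevanlinna μ t x : ℂ) + I * (1 : ℝ)) / (nevanlinna μ t x - I * (1 : ℝ)) := by
    filter_upwards [hev] with x hx
    simp [spectralCurve, if_neg hx]
  obtain ⟨h1, h2⟩ := analyticAt_hasDerivAt_of_eventuallyEq_ratio (p := fun _ => 1)
    analyticAt_const hN (hasDerivAt_const s 1) hN' (Or.inl one_ne_zero) hα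
  refine ⟨h1, h2.congr_deriv ?_⟩
  congr 4
  ring

/-- Multiplying numerator and denominator by x−tₘ removes the pole. At tₘ the pair (p, q) is (0,
(1+tₘ²)μₘ) with p' = 1, so the speed depends only on q(tₘ), not on q'. -/
theorem spectralCurve_of_mem (m : ι) :
    AnalyticAt ℝ (spectralCurve μ t) (t m) ∧
      HasDerivAt (spectralCurve μ t) (2 * Real.pi * I *
        (1 / ((1 + t m ^ 2) * μ m) / Real.pi : ℝ) * spectralCurve μ t (t m)) (t m) := by
  classical
  obtain ⟨δ, hδ, H⟩ := exists_pos_le_abs_sub_of_not_accPt (h.noAcc (t m))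
  -- Deleting the mass at tₘ leaves a Cauchy sum that is analytic there.
  set ν : ι → ℝ := Function.update μ m 0 with hν
  have hνs : Summable ν := h.hasSum.summable.update m 0
  have hν0 : ∀ n, 0 ≤ ν n := fun n => by
    by_cases e : n = m
    · subst e; simp [hν]
    · simpa [hν, e] using (h.pos n).le
  have hνδ : ∀ n, ν n ≠ 0 → δ ≤ |t m - t n| := fun n hn => by
    refine H n fun e => hn ?_
    rw [h.injective e]; simp [hν]
  have hA := analyticAt_realCauchySum hνs hν0 hδ hνδ
  have hD := hasDerivAt_realCauchySum hνs hν0 hδ hνδ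
  set p : ℝ → ℝ := fun x => x - t m
  set q : ℝ → ℝ := fun x =>
    (x - t m) * (-x + (1 + x ^ 2) * realCauchySum ν t x) + (1 + x ^ 2) * μ m
  have hpA : AnalyticAt ℝ p (t m) := analyticAt_id.sub analyticAt_const
  have hxA : AnalyticAt ℝ (fun x : ℝ => 1 + x ^ 2) (t m) :=
    analyticAt_const.add (analyticAt_id.pow 2)
  have hqA : AnalyticAt ℝ q (t m) :=
    (hpA.mul (analyticAt_id.neg.add (hxA.mul hA))).add (hxA.mul analyticAt_const)
  have hp' : HasDerivAt p 1 (t m) := (hasDerivAt_id _).sub_const _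
  have hq' := hqA.differentiableAt.hasDerivAt
  have hqm : q (t m) = (1 + t m ^ 2) * μ m := by simp [q]
  have hpm : p (t m) = 0 := by simp [p]
  have hqpos : 0 < q (t m) := by rw [hqm]; have := h.pos m; positivity
  have hα : spectralCurve μ t =ᶠ[𝓝 (t m)]
      fun x => ((q x : ℂ) + I * p x) / (q x - I * p x) := by
    have hev := h.eventually_notMem_range (t m)
    rw [eventually_nhdsWithin_iff] at hev
    filter_upwards [hev] with x hx
    by_cases e : x = t m
    · subst e
      have : (q (t m) : ℂ) ≠ 0 := by exact_mod_cast hqpos.ne'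
      simp [spectralCurve, hpm, this]
    · have hx := hx e
      have hxm : x - t m ≠ 0 := sub_ne_zero.2 e
      have hsplit : realCauchySum μ t x = μ m / (x - t m) + realCauchySum ν t x := by
        unfold realCauchySum
        rw [(h.summable_div hx).tsum_eq_add_tsum_ite m]
        congr 1
        refine tsum_congr fun n => ?_
        by_cases e : n = m
        · subst e; simp [hν]
        · simp [hν, e]
      have hq : q x = (x - t m) * nevanlinna μ t x := by
        simp only [q, nevanlinna, hsplit]
        field_simp
        ring
      have hxm' : ((x - t m : ℝ) : ℂ) ≠ 0 := by exact_mod_cast hxm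
      rw [spectralCurve, if_neg hx, hq]
      simp only [p]
      rw [ofReal_mul, show ((x - t m : ℝ) : ℂ) * (nevanlinna μ t x : ℂ) + I * ((x - t m : ℝ) : ℂ)
        = ((x - t m : ℝ) : ℂ) * (nevanlinna μ t x + I) by ring,
        show ((x - t m : ℝ) : ℂ) * (nevanlinna μ t x : ℂ) - I * ((x - t m : ℝ) : ℂ)
        = ((x - t m : ℝ) : ℂ) * (nevanlinna μ t x - I) by ring, mul_div_mul_left _ _ hxm']
  obtain ⟨h1, h2⟩ := analyticAt_hasDerivAt_of_eventuallyEq_ratio hpA hqA hp' hq'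
    (Or.inr hqpos.ne') hα
  refine ⟨h1, h2.congr_deriv ?_⟩
  rw [hpm, ← hqm]
  congr 4
  field_simp
  ring

theorem exists_pos_hasDerivAt (s : ℝ) : ∃ κ : ℝ, 0 < κ ∧
    HasDerivAt (spectralCurve μ t) (2 * Real.pi * I * κ * spectralCurve μ t s) s := by
  by_cases hs : s ∈ Set.range t
  · obtain ⟨m, rfl⟩ := hs
    exact ⟨_, by have := h.pos m; positivity, (h.spectralCurve_of_mem m).2⟩
  · refine ⟨_, ?_, (h.spectralCurve_of_notMem hs).2⟩
    have h1 := h.sq_realCauchySum_le hs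
    have h2 := h.tsum_div_sq_pos hs
    refine div_pos (div_pos ?_ (by positivity)) Real.pi_pos
    set G := realCauchySum μ t s
    set E := ∑' n, μ n / (s - t n) ^ 2
    -- The numerator equals (1−sG)² + E + s²(E−G²), with E > 0 and E ≥ G².
    nlinarith [sq_nonneg (1 - s * G), mul_nonneg (sq_nonneg s) (sub_nonneg.2 h1)]

theorem one_le_of_hasDerivAt_zero {κ : ℝ}
    (hκ : HasDerivAt (spectralCurve μ t) (2 * Real.pi * I * κ * spectralCurve μ t 0) 0) :
    1 ≤ Real.pi * κ ∧ (∀ m n : ι, m ≠ n → 1 < Real.pi * κ) ∧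
      ∀ m, t m = 0 → Real.pi * κ = 1 / μ m := by
  have hne : spectralCurve μ t 0 ≠ 0 := by
    rw [← norm_ne_zero_iff, norm_spectralCurve]; exact one_ne_zero
  have huniq : ∀ κ' : ℝ,
      HasDerivAt (spectralCurve μ t) (2 * Real.pi * I * κ' * spectralCurve μ t 0) 0 →
        κ = κ' := fun κ' h' => by
    have e := mul_left_cancel₀ Complex.two_pi_I_ne_zero
      (mul_right_cancel₀ hne (hκ.unique h'))
    exact_mod_cast e
  have hpi := Real.pi_pos
  by_cases hs : (0 : ℝ) ∈ Set.range t
  · obtain ⟨m, hm⟩ := hs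
    have h1 := (h.spectralCurve_of_mem m).2
    rw [hm] at h1
    have h2 : Real.pi * κ = 1 / μ m := by
      rw [huniq _ h1]
      field_simp
      simp
    have hpos := h.pos m
    refine ⟨?_, fun a b hab => ?_, fun k hk => ?_⟩
    · rw [h2, le_div_iff₀ hpos, one_mul]
      exact h.le_one m
    · rw [h2, lt_div_iff₀ hpos, one_mul]
      by_cases e : a = m
      · subst e; exact h.lt_one_of_ne hab
      · exact h.lt_one_of_ne fun e' => e e'.symm
    · rw [h2, h.injective (hk.trans hm.symm)]
  · have h1 := huniq _ (h.spectralCurve_of_notMem hs).2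
    have h2 : Real.pi * κ = (1 + ∑' n, μ n / (0 - t n) ^ 2) / (1 + realCauchySum μ t 0 ^ 2) := by
      rw [h1]
      simp only [nevanlinna]
      field_simp
      ring
    refine ⟨?_, fun a b hab => ?_, fun k hk => absurd ⟨k, hk⟩ hs⟩
    · rw [h2, le_div_iff₀ (by positivity)]
      linarith [h.sq_realCauchySum_le hs]
    · rw [h2, lt_div_iff₀ (by positivity)]
      linarith [h.sq_realCauchySum_lt hs hab]

/-- The constant c accounts for the choice of deficiency vectors; it rotates the curve and leaves
its speed unchanged. -/
theorem exists_spectralPhase {c : ℂ} (hc : ‖c‖ = 1) : ∃ τ : ℝ → ℝ, StrictMono τ ∧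
    (∀ s, exp (2 * Real.pi * I * τ s) = c * spectralCurve μ t s) ∧
    (∀ s, DifferentiableAt ℝ τ s) ∧
    1 ≤ Real.pi * deriv τ 0 ∧ (∀ m n : ι, m ≠ n → 1 < Real.pi * deriv τ 0) ∧
    ∀ m, t m = 0 → Real.pi * deriv τ 0 = 1 / μ m := by
  choose κ hκ0 hκ using h.exists_pos_hasDerivAt
  have hAn : AnalyticOnNhd ℝ (spectralCurve μ t) Set.univ := fun s _ => by
    by_cases hs : s ∈ Set.range t
    · obtain ⟨m, rfl⟩ := hs
      exact (h.spectralCurve_of_mem m).1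
    · exact (h.spectralCurve_of_notMem hs).1
  have hne : ∀ s, spectralCurve μ t s ≠ 0 := fun s => by
    rw [← norm_ne_zero_iff, norm_spectralCurve]; exact one_ne_zero
  have hcont : Continuous (spectralCurve μ t) := hAn.continuous
  have hderiv : Continuous (deriv (spectralCurve μ t)) := hAn.deriv.continuous
  -- The speeds were chosen pointwise; continuity comes from κ = α'/(2πiα) with α real analytic and
  -- nonvanishing.
  have hκc : Continuous κ := by
    have h1 : κ = fun s => (deriv (spectralCurve μ t) s /
        (2 * Real.pi * I * spectralCurve μ t s)).re := by
      funext s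
      rw [(hκ s).deriv]
      have : 2 * Real.pi * I * κ s * spectralCurve μ t s / (2 * Real.pi * I * spectralCurve μ t s)
          = κ s := by
        have h1 := Complex.two_pi_I_ne_zero
        have h2 := hne s
        rw [mul_right_comm, mul_div_cancel_left₀ _ (mul_ne_zero h1 h2)]
      rw [this, ofReal_re]
    rw [h1]
    exact continuous_re.comp (hderiv.div (continuous_const.mul hcont)
      fun s => mul_ne_zero Complex.two_pi_I_ne_zero (hne s))
  obtain ⟨τ, hτ, hexp⟩ := exists_phase (α := fun s => c * spectralCurve μ t s) hκc
    (fun s => ((hκ s).const_mul c).congr_deriv (by ring))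
    (by rw [norm_mul, hc, norm_spectralCurve, one_mul])
  have h0 := h.one_le_of_hasDerivAt_zero (hκ 0)
  rw [← (hτ 0).deriv] at h0
  exact ⟨τ, strictMono_of_deriv_pos fun s => by rw [(hτ s).deriv]; exact hκ0 s, hexp,
    fun s => (hτ s).differentiableAt, h0⟩

end IsDiscreteProb

/-! ### The operator of a bandlimit pair in coordinates -/

/-- The probability weights `t'ₙ / (π (1 + tₙ²))` of a normalized bandlimit pair. -/
def bandMass {F : Set ℤ} (t t' : F → ℝ) (n : F) : ℝ := t' n / (1 + t n ^ 2) / Real.pi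

theorem IsNormalizedBandlimitPair.isDiscreteProb {F : Set ℤ} {t t' : F → ℝ}
    (h : IsNormalizedBandlimitPair F t t') : IsDiscreteProb (bandMass t t') t where
  hasSum := by
    have := h.normalized.div_const Real.pi
    rwa [div_self Real.pi_ne_zero] at this
  pos n := by
    have := h.pos n
    have := Real.pi_pos
    unfold bandMass
    positivity
  injective := h.strictMono.injective
  noAcc := h.noAcc

/-- The factor 1+tₙ² is split so that it cancels against the denominators tₙ ∓ i of φ⁰±. -/
theorem sq_sqrt_eq_bandMass {F : Set ℤ} {t t' : F → ℝ} (hpos : ∀ n, 0 < t' n) (n : F) :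
    ((Real.sqrt (t' n) : ℝ) : ℂ) ^ 2
      = Real.pi * (bandMass t t' n * ((t n + I) * (t n - I))) := by
  rw [← ofReal_pow, Real.sq_sqrt (hpos n).le]
  have h1 : t' n = Real.pi * (bandMass t t' n * (1 + t n ^ 2)) := by
    unfold bandMass
    have h2 : (1 + t n ^ 2) ≠ 0 := by positivity
    have := Real.pi_ne_zero
    field_simp
  have h2 : ((t n : ℂ) + I) * (t n - I) = ((1 + t n ^ 2 : ℝ) : ℂ) := by
    push_cast
    linear_combination -I_sq
  rw [h2]
  exact_mod_cast h1

theorem memℓp_two_of_sq_le {ι : Type*} {f : ι → ℂ} {u : ι → ℝ} (hu : Summable u)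
    (hf : ∀ n, ‖f n‖ ^ 2 ≤ u n) : Memℓp f 2 := by
  refine memℓp_gen ?_
  simp only [ENNReal.toReal_ofNat, Real.rpow_two]
  exact Summable.of_nonneg_of_le (fun n => by positivity) hf hu

theorem memℓp_two_of_norm_le {ι : Type*} {f g : ι → ℂ} (hg : Memℓp g 2)
    (hf : ∀ n, ‖f n‖ ≤ ‖g n‖) : Memℓp f 2 := by
  have h1 := hg.summable (by simp)
  simp only [ENNReal.toReal_ofNat, Real.rpow_two] at h1
  exact memℓp_two_of_sq_le h1 fun n => pow_le_pow_left₀ (norm_nonneg _) (hf n) 2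

section

variable {F : Set ℤ} {t t' : F → ℝ} {H : Type*} [NormedAddCommGroup H] [InnerProductSpace ℂ H]
  (ψ : HilbertBasis F ℂ H)

theorem HilbertBasis.ext_repr {x y : H} (h : ∀ n, ψ.repr x n = ψ.repr y n) : x = y :=
  ψ.repr.injective (lp.ext (funext h))

theorem HilbertBasis.hasSum_conj_repr_mul_repr (x y : H) :
    HasSum (fun n => (starRingEnd ℂ) (ψ.repr x n) * ψ.repr y n) (inner ℂ x y) := by
  refine (ψ.hasSum_inner_mul_inner x y).congr_fun fun n => ?_
  rw [ψ.repr_apply_apply, ψ.repr_apply_apply, inner_conj_symm]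

theorem HilbertBasis.repr_add_apply (x y : H) (n : F) :
    ψ.repr (x + y) n = ψ.repr x n + ψ.repr y n := by
  rw [map_add, lp.coeFn_add, Pi.add_apply]

theorem HilbertBasis.repr_sub_apply (x y : H) (n : F) :
    ψ.repr (x - y) n = ψ.repr x n - ψ.repr y n := by
  rw [map_sub, lp.coeFn_sub, Pi.sub_apply]

theorem HilbertBasis.repr_smul_apply (c : ℂ) (x : H) (n : F) :
    ψ.repr (c • x) n = c * ψ.repr x n := by
  rw [map_smul, lp.coeFn_smul, Pi.smul_apply, smul_eq_mul]

theorem HilbertBasis.repr_zero_apply (n : F) : ψ.repr (0 : H) n = 0 := by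
  rw [map_zero, lp.coeFn_zero, Pi.zero_apply]

theorem HilbertBasis.repr_self_apply_self (n : F) : ψ.repr (ψ n) n = 1 := by
  classical
  rw [ψ.repr_self, lp.coeFn_single, Pi.single_eq_same]

theorem HilbertBasis.repr_self_apply_of_ne {m n : F} (h : m ≠ n) : ψ.repr (ψ n) m = 0 := by
  classical
  rw [ψ.repr_self, lp.coeFn_single, Pi.single_eq_of_ne h]

theorem repr_diagOp (x : (diagOp ψ t).domain) (n : F) :
    ψ.repr (diagOp ψ t x) n = t n * ψ.repr (x : H) n := by
  change ψ.repr (ψ.repr.symm (diagSeq ψ t x)) n = _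
  rw [LinearIsometryEquiv.apply_symm_apply]
  exact diagSeq_apply ψ t x n

theorem basis_mem_diagDomain (n : F) : ψ n ∈ (diagOp ψ t).domain := by
  change Memℓp (fun k : F => (t k : ℂ) * ψ.repr (ψ n) k) 2
  have e : (fun k : F => (t k : ℂ) * ψ.repr (ψ n) k) = (t n : ℂ) • ⇑(ψ.repr (ψ n)) := by
    funext k
    by_cases hk : k = n
    · subst hk; simp
    · simp [ψ.repr_self_apply_of_ne hk]
  rw [e]
  exact (lp.memℓp (ψ.repr (ψ n))).const_smul _

/-- Surjectivity of T₀ + i: since |tₙ+i| ≥ max(1, |tₙ|), dividing coordinates by tₙ+i stays in ℓ²,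
even after multiplication by tₙ. -/
theorem exists_resolvent (y : H) :
    ∃ x : (diagOp ψ t).domain, ∀ n, ((t n : ℂ) + I) * ψ.repr (x : H) n = ψ.repr y n := by
  have hy := lp.memℓp (ψ.repr y)
  have hnorm : ∀ n, 1 ≤ ‖(t n : ℂ) + I‖ ∧ ‖(t n : ℂ)‖ ≤ ‖(t n : ℂ) + I‖ := fun n => by
    constructor
    · have := Complex.abs_im_le_norm ((t n : ℂ) + I)
      simpa using this
    · have := Complex.abs_re_le_norm ((t n : ℂ) + I)
      simpa using this
  have h1 : Memℓp (fun n => ψ.repr y n / ((t n : ℂ) + I)) 2 :=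
    memℓp_two_of_norm_le hy fun n => by
      rw [norm_div]
      exact div_le_self (norm_nonneg _) (hnorm n).1
  have h2 : Memℓp (fun n => (t n : ℂ) * (ψ.repr y n / ((t n : ℂ) + I))) 2 :=
    memℓp_two_of_norm_le hy fun n => by
      rw [norm_mul, norm_div, ← mul_div_assoc, mul_comm,
        div_le_iff₀ (by linarith [(hnorm n).1])]
      exact mul_le_mul_of_nonneg_left (hnorm n).2 (norm_nonneg _)
  have hr : ∀ n, ψ.repr (ψ.repr.symm ⟨_, h1⟩) n = ψ.repr y n / ((t n : ℂ) + I) := fun n => by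
    rw [LinearIsometryEquiv.apply_symm_apply]
  refine ⟨⟨ψ.repr.symm ⟨_, h1⟩, ?_⟩, fun n => ?_⟩
  · change Memℓp (fun n : F => (t n : ℂ) * ψ.repr (ψ.repr.symm ⟨_, h1⟩) n) 2
    simpa only [hr] using h2
  · rw [hr, mul_div_cancel₀ _ (ofReal_add_I_ne_zero _)]

theorem mem_symmOp_domain {x : H} : x ∈ (symmOp ψ t t').domain ↔
    ∃ h : x ∈ (diagOp ψ t).domain,
      inner ℂ (phiPlus ψ t t') (diagOp ψ t ⟨x, h⟩ + I • x) = 0 :=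
  ⟨fun h => h.1, fun h => ⟨h, h.1⟩⟩

theorem symmOp_apply (x : (symmOp ψ t t').domain) :
    symmOp ψ t t' x = diagOp ψ t ⟨x, x.2.2⟩ := rfl

theorem repr_symmOp (x : (symmOp ψ t t').domain) (n : F) :
    ψ.repr (symmOp ψ t t' x) n = t n * ψ.repr (x : H) n := by
  rw [symmOp_apply, repr_diagOp]

theorem inner_phiPlus_symmOp (x : (symmOp ψ t t').domain) :
    inner ℂ (phiPlus ψ t t') (symmOp ψ t t' x + I • (x : H)) = 0 := x.2.1.2

end

/-! ### Kernel vectors and deficiency spaces. -/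

namespace IsNormalizedBandlimitPair

variable {F : Set ℤ} {t t' : F → ℝ} (h : IsNormalizedBandlimitPair F t t')
  {H : Type*} [NormedAddCommGroup H] [InnerProductSpace ℂ H] (ψ : HilbertBasis F ℂ H)

include h

theorem memℓp_kernel {z : ℂ} {δ : ℝ} (hδ : 0 < δ) (hz : ∀ n, δ ≤ ‖(t n : ℂ) - z‖) :
    Memℓp (fun n : F => (Real.sqrt (t' n) : ℂ) / ((t n : ℂ) - z)) 2 := by
  -- The constant comes from tₙ² ≤ 2|tₙ−z|² + 2|z|² together with |tₙ−z| ≥ δ, which bound 1+tₙ² by a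
  -- multiple of |tₙ−z|².
  refine memℓp_two_of_sq_le
    (h.isDiscreteProb.hasSum.summable.mul_left (Real.pi * (2 + (1 + 2 * ‖z‖ ^ 2) / δ ^ 2)))
    fun n => ?_
  have hb := h.isDiscreteProb.pos n
  have hd := hz n
  have h0 : 0 < ‖(t n : ℂ) - z‖ := lt_of_lt_of_le hδ hd
  have h1 : t' n = Real.pi * (bandMass t t' n * (1 + t n ^ 2)) := by
    unfold bandMass
    have h2 : (1 + t n ^ 2) ≠ 0 := by positivity
    have := Real.pi_ne_zero
    field_simp
  rw [norm_div, div_pow, Complex.norm_real, Real.norm_eq_abs, sq_abs, Real.sq_sqrt (h.pos n).le,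
    h1, div_le_iff₀ (by positivity)]
  have h2 : |t n| ≤ ‖(t n : ℂ) - z‖ + ‖z‖ := by
    have := norm_add_le ((t n : ℂ) - z) z
    simpa using this
  have h3 : t n ^ 2 ≤ 2 * ‖(t n : ℂ) - z‖ ^ 2 + 2 * ‖z‖ ^ 2 := by
    rw [← sq_abs]
    have := pow_le_pow_left₀ (abs_nonneg _) h2 2
    nlinarith [sq_nonneg (‖(t n : ℂ) - z‖ - ‖z‖)]
  have h4 : (1 + 2 * ‖z‖ ^ 2) ≤ (1 + 2 * ‖z‖ ^ 2) / δ ^ 2 * ‖(t n : ℂ) - z‖ ^ 2 := by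
    rw [div_mul_eq_mul_div, le_div_iff₀ (by positivity)]
    exact mul_le_mul_of_nonneg_left (pow_le_pow_left₀ hδ.le hd 2) (by positivity)
  have h5 : 1 + t n ^ 2 ≤ (2 + (1 + 2 * ‖z‖ ^ 2) / δ ^ 2) * ‖(t n : ℂ) - z‖ ^ 2 := by
    rw [add_mul]; linarith
  calc Real.pi * (bandMass t t' n * (1 + t n ^ 2))
      ≤ Real.pi * (bandMass t t' n *
        ((2 + (1 + 2 * ‖z‖ ^ 2) / δ ^ 2) * ‖(t n : ℂ) - z‖ ^ 2)) := by
        gcongr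
    _ = _ := by ring

theorem exists_kernel {z : ℂ} {δ : ℝ} (hδ : 0 < δ) (hz : ∀ n, δ ≤ ‖(t n : ℂ) - z‖) :
    ∃ φ : H, ∀ n, ((t n : ℂ) - z) * ψ.repr φ n = Real.sqrt (t' n) := by
  refine ⟨ψ.repr.symm ⟨_, h.memℓp_kernel hδ hz⟩, fun n => ?_⟩
  rw [LinearIsometryEquiv.apply_symm_apply]
  exact mul_div_cancel₀ _ (norm_pos_iff.1 (lt_of_lt_of_le hδ (hz n)))

theorem repr_phiPlus (n : F) :
    ((t n : ℂ) - I) * ψ.repr (phiPlus ψ t t') n = Real.sqrt (t' n) := by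
  have hm := h.memℓp_kernel (z := I) one_pos fun n => by
    simpa using Complex.abs_im_le_norm ((t n : ℂ) - I)
  have h1 : phiPlus ψ t t' = ψ.repr.symm ⟨_, hm⟩ := (ψ.hasSum_repr_symm ⟨_, hm⟩).tsum_eq
  rw [h1, LinearIsometryEquiv.apply_symm_apply]
  exact mul_div_cancel₀ _ (ofReal_sub_I_ne_zero _)

theorem repr_phiMinus (n : F) :
    ((t n : ℂ) + I) * ψ.repr (phiMinus ψ t t') n = Real.sqrt (t' n) := by
  have hm := h.memℓp_kernel (z := -I) one_pos fun n => by
    simpa using Complex.abs_im_le_norm ((t n : ℂ) - -I)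
  simp only [sub_neg_eq_add] at hm
  have h1 : phiMinus ψ t t' = ψ.repr.symm ⟨_, hm⟩ := (ψ.hasSum_repr_symm ⟨_, hm⟩).tsum_eq
  rw [h1, LinearIsometryEquiv.apply_symm_apply]
  exact mul_div_cancel₀ _ (ofReal_add_I_ne_zero _)

theorem conj_repr_phiPlus (n : F) :
    ((t n : ℂ) + I) * (starRingEnd ℂ) (ψ.repr (phiPlus ψ t t') n) = Real.sqrt (t' n) := by
  have := congrArg (starRingEnd ℂ) (h.repr_phiPlus ψ n)
  simpa using this

/-- The factor tₙ+i from T₀ + i cancels the conjugated denominator of φ⁰₊. The domain condition thus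
no longer involves i, which is why one formula describes the defect vectors at every z. -/
theorem hasSum_sqrt_mul_repr (x : (symmOp ψ t t').domain) :
    HasSum (fun n => (Real.sqrt (t' n) : ℂ) * ψ.repr (x : H) n) 0 := by
  have h1 := ψ.hasSum_conj_repr_mul_repr (phiPlus ψ t t') (symmOp ψ t t' x + I • (x : H))
  rw [inner_phiPlus_symmOp] at h1
  refine h1.congr_fun fun n => ?_
  rw [ψ.repr_add_apply, ψ.repr_smul_apply, repr_symmOp, ← h.conj_repr_phiPlus ψ n]
  ring

theorem isDefect_of_forall {z : ℂ} {φ : H} {c : ℂ}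
    (hφ : ∀ n, ((t n : ℂ) - (starRingEnd ℂ) z) * ψ.repr φ n = c * Real.sqrt (t' n)) :
    IsDefect (symmOp ψ t t') z φ := by
  intro x
  refine (ψ.hasSum_conj_repr_mul_repr _ _).unique ?_
  have h1 := ((Complex.hasSum_conj'.2 (h.hasSum_sqrt_mul_repr ψ x))).mul_left c
  rw [map_zero, mul_zero] at h1
  refine h1.congr_fun fun n => ?_
  rw [ψ.repr_sub_apply, ψ.repr_smul_apply, repr_symmOp]
  simp only [map_sub, map_mul, conj_ofReal]
  linear_combination (starRingEnd ℂ) (ψ.repr (x : H) n) * hφ n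

/-- Testing against √t'ₘ ψₙ − √t'ₙ ψₘ, which lies in dom T, shows that (tₙ−z̄)φₙ is proportional to
√t'ₙ. -/
theorem exists_of_isDefect {z : ℂ} {φ : H} (hφ : IsDefect (symmOp ψ t t') z φ) :
    ∃ c : ℂ, ∀ n, ((t n : ℂ) - (starRingEnd ℂ) z) * ψ.repr φ n = c * Real.sqrt (t' n) := by
  obtain ⟨m⟩ := h.isDiscreteProb.nonempty
  have hsq : ∀ n, (Real.sqrt (t' n) : ℂ) ≠ 0 := fun n => by
    exact_mod_cast (Real.sqrt_pos.2 (h.pos n)).ne'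
  refine ⟨((t m : ℂ) - (starRingEnd ℂ) z) * ψ.repr φ m / Real.sqrt (t' m), fun n => ?_⟩
  set a : ℂ := ((Real.sqrt (t' m) : ℝ) : ℂ)
  set b : ℂ := ((Real.sqrt (t' n) : ℝ) : ℂ)
  have hmem : a • ψ n - b • ψ m ∈ (diagOp ψ t).domain :=
    Submodule.sub_mem _ (Submodule.smul_mem _ _ (basis_mem_diagDomain ψ n))
      (Submodule.smul_mem _ _ (basis_mem_diagDomain ψ m))
  have hdiag : diagOp ψ t ⟨_, hmem⟩ = (a * t n) • ψ n - (b * t m) • ψ m := by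
    refine ψ.ext_repr fun k => ?_
    rw [repr_diagOp]
    simp only [ψ.repr_sub_apply, ψ.repr_smul_apply]
    have hn : (t k : ℂ) * ψ.repr (ψ n) k = t n * ψ.repr (ψ n) k := by
      by_cases e : k = n
      · rw [e]
      · rw [ψ.repr_self_apply_of_ne e]; simp
    have hm : (t k : ℂ) * ψ.repr (ψ m) k = t m * ψ.repr (ψ m) k := by
      by_cases e : k = m
      · rw [e]
      · rw [ψ.repr_self_apply_of_ne e]; simp
    linear_combination a * hn - b * hm
  have hdom : a • ψ n - b • ψ m ∈ (symmOp ψ t t').domain := by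
    refine (mem_symmOp_domain ψ).2 ⟨hmem, ?_⟩
    rw [hdiag]
    have h1 : inner ℂ (phiPlus ψ t t') (ψ n) = (starRingEnd ℂ) (ψ.repr (phiPlus ψ t t') n) := by
      rw [ψ.repr_apply_apply, inner_conj_symm]
    have h2 : inner ℂ (phiPlus ψ t t') (ψ m) = (starRingEnd ℂ) (ψ.repr (phiPlus ψ t t') m) := by
      rw [ψ.repr_apply_apply, inner_conj_symm]
    simp only [inner_add_right, inner_sub_right, inner_smul_right, h1, h2]
    linear_combination a * h.conj_repr_phiPlus ψ n - b * h.conj_repr_phiPlus ψ m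
  have h1 := hφ ⟨_, hdom⟩
  rw [symmOp_apply] at h1
  change inner ℂ (diagOp ψ t ⟨_, hmem⟩ - z • (a • ψ n - b • ψ m)) φ = 0 at h1
  rw [hdiag] at h1
  simp only [inner_sub_left, inner_smul_left, ← ψ.repr_apply_apply, map_mul, a, b,
    conj_ofReal] at h1
  have ha : a ≠ 0 := hsq m
  field_simp
  linear_combination h1

/-- Termwise, t'ₙ/((tₙ−z)(tₙ∓i)) = πμₙ(tₙ±i)/(tₙ−z) = πμₙ(1 − (z±i)/(z−tₙ)), and ∑ μₙ = 1. Only a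
gap between z and the tₙ is needed, so this serves both the upper half-plane and real s off the
spectrum of T₀. -/
theorem inner_kernel {z φ' : ℂ} {φ : H} {δ : ℝ} (hδ : 0 < δ) (hz : ∀ n, δ ≤ ‖z - t n‖)
    (hφ : ∀ n, ((t n : ℂ) - (starRingEnd ℂ) z) * ψ.repr φ n = φ' * Real.sqrt (t' n)) :
    inner ℂ φ (phiPlus ψ t t')
        = (starRingEnd ℂ) φ' * Real.pi * (1 - (z + I) * cauchySum (bandMass t t') t z) ∧
      inner ℂ φ (phiMinus ψ t t')
        = (starRingEnd ℂ) φ' * Real.pi * (1 - (z - I) * cauchySum (bandMass t t') t z) := by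
  have hP := h.isDiscreteProb
  have h1 : HasSum (fun n => (bandMass t t' n : ℂ)) 1 := by
    simpa using Complex.hasSum_ofReal.2 hP.hasSum
  have h2 := (summable_div_of_le hP.hasSum.summable (fun n => (hP.pos n).le) hδ
    fun n _ => hz n).hasSum
  have hφ' : ∀ n, ((t n : ℂ) - z) * (starRingEnd ℂ) (ψ.repr φ n)
      = (starRingEnd ℂ) φ' * Real.sqrt (t' n) := fun n => by
    have := congrArg (starRingEnd ℂ) (hφ n)
    simpa using this
  have hne : ∀ n, z - t n ≠ 0 := fun n => norm_pos_iff.1 (lt_of_lt_of_le hδ (hz n))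
  constructor
  · have h3 := ((h1.sub (h2.mul_left (z + I))).mul_left ((starRingEnd ℂ) φ' * Real.pi))
    refine (ψ.hasSum_conj_repr_mul_repr _ _).unique (h3.congr_fun fun n => ?_)
    have h4 := sq_sqrt_eq_bandMass (t := t) h.pos n
    have h5 := h.repr_phiPlus ψ n
    have h6 := hφ' n
    have hd : (t n : ℂ) - I ≠ 0 := ofReal_sub_I_ne_zero _
    have hn := hne n
    have hn' : (t n : ℂ) - z ≠ 0 := by rw [← neg_ne_zero, neg_sub]; exact hn
    refine mul_left_cancel₀ (mul_ne_zero hn' hd) ?_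
    have h7 : ((t n : ℂ) - z) * (t n - I) * ((starRingEnd ℂ) (ψ.repr φ n)
        * ψ.repr (phiPlus ψ t t') n) = (starRingEnd ℂ) φ' * (Real.sqrt (t' n) : ℂ) ^ 2 := by
      linear_combination (t n - I) * ψ.repr (phiPlus ψ t t') n * h6
        + (starRingEnd ℂ) φ' * Real.sqrt (t' n) * h5
    rw [h7, h4]
    field_simp
    ring
  · have h3 := ((h1.sub (h2.mul_left (z - I))).mul_left ((starRingEnd ℂ) φ' * Real.pi))
    refine (ψ.hasSum_conj_repr_mul_repr _ _).unique (h3.congr_fun fun n => ?_)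
    have h4 := sq_sqrt_eq_bandMass (t := t) h.pos n
    have h5 := h.repr_phiMinus ψ n
    have h6 := hφ' n
    have hd : (t n : ℂ) + I ≠ 0 := ofReal_add_I_ne_zero _
    have hn := hne n
    have hn' : (t n : ℂ) - z ≠ 0 := by rw [← neg_ne_zero, neg_sub]; exact hn
    refine mul_left_cancel₀ (mul_ne_zero hn' hd) ?_
    have h7 : ((t n : ℂ) - z) * (t n + I) * ((starRingEnd ℂ) (ψ.repr φ n)
        * ψ.repr (phiMinus ψ t t') n) = (starRingEnd ℂ) φ' * (Real.sqrt (t' n) : ℂ) ^ 2 := by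
      linear_combination (t n + I) * ψ.repr (phiMinus ψ t t') n * h6
        + (starRingEnd ℂ) φ' * Real.sqrt (t' n) * h5
    rw [h7, h4]
    field_simp
    ring

theorem norm_phiPlus_sq : ‖phiPlus ψ t t'‖ ^ 2 = Real.pi := by
  have h1 : HasSum (fun n => ((Real.pi * bandMass t t' n : ℝ) : ℂ)) ((Real.pi * 1 : ℝ) : ℂ) :=
    Complex.hasSum_ofReal.2 (h.isDiscreteProb.hasSum.mul_left Real.pi)
  have h2 := (ψ.hasSum_conj_repr_mul_repr (phiPlus ψ t t') (phiPlus ψ t t')).unique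
    (h1.congr_fun fun n => by
      have h4 := sq_sqrt_eq_bandMass (t := t) h.pos n
      have h5 := h.repr_phiPlus ψ n
      have h6 := h.conj_repr_phiPlus ψ n
      refine mul_left_cancel₀ (mul_ne_zero (ofReal_add_I_ne_zero (t n))
        (ofReal_sub_I_ne_zero (t n))) ?_
      push_cast
      linear_combination (t n - I) * ψ.repr (phiPlus ψ t t') n * h6
        + (Real.sqrt (t' n)) * h5 + h4)
  rw [inner_self_eq_norm_sq_to_K] at h2
  rw [mul_one] at h2
  exact Complex.ofReal_injective (by rw [ofReal_pow]; exact h2)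

theorem norm_phiMinus_sq : ‖phiMinus ψ t t'‖ ^ 2 = Real.pi := by
  have h1 : HasSum (fun n => ((Real.pi * bandMass t t' n : ℝ) : ℂ)) ((Real.pi * 1 : ℝ) : ℂ) :=
    Complex.hasSum_ofReal.2 (h.isDiscreteProb.hasSum.mul_left Real.pi)
  have h2 := (ψ.hasSum_conj_repr_mul_repr (phiMinus ψ t t') (phiMinus ψ t t')).unique
    (h1.congr_fun fun n => by
      have h4 := sq_sqrt_eq_bandMass (t := t) h.pos n
      have h5 := h.repr_phiMinus ψ n
      have h6 := congrArg (starRingEnd ℂ) h5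
      simp only [map_mul, map_add, conj_ofReal, conj_I] at h6
      refine mul_left_cancel₀ (mul_ne_zero (ofReal_add_I_ne_zero (t n))
        (ofReal_sub_I_ne_zero (t n))) ?_
      push_cast
      linear_combination (t n + I) * ψ.repr (phiMinus ψ t t') n * h6
        + (Real.sqrt (t' n)) * h5 + h4)
  rw [inner_self_eq_norm_sq_to_K] at h2
  rw [mul_one] at h2
  exact Complex.ofReal_injective (by rw [ofReal_pow]; exact h2)

theorem isDefectPair : IsDefectPair (symmOp ψ t t') (phiPlus ψ t t') (phiMinus ψ t t') where
  plus := h.isDefect_of_forall ψ (c := 1) fun n => by simpa using h.repr_phiPlus ψ n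
  minus := h.isDefect_of_forall ψ (c := 1) fun n => by simpa using h.repr_phiMinus ψ n
  norm_eq := by
    rw [← sq_eq_sq₀ (norm_nonneg _) (norm_nonneg _), h.norm_phiPlus_sq, h.norm_phiMinus_sq]
  ne_zero := by
    intro e
    have := h.norm_phiPlus_sq ψ
    rw [e] at this
    simp at this
    exact Real.pi_ne_zero this.symm

theorem eq_smul_phiPlus {φ : H} (hφ : IsDefect (symmOp ψ t t') (-I) φ) :
    ∃ a : ℂ, φ = a • phiPlus ψ t t' := by
  obtain ⟨a, ha⟩ := h.exists_of_isDefect ψ hφ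
  refine ⟨a, ψ.ext_repr fun n => mul_left_cancel₀ (ofReal_sub_I_ne_zero (t n)) ?_⟩
  rw [ψ.repr_smul_apply]
  have h1 := ha n
  rw [map_neg, conj_I, neg_neg] at h1
  linear_combination h1 - a * h.repr_phiPlus ψ n

theorem eq_smul_phiMinus {φ : H} (hφ : IsDefect (symmOp ψ t t') I φ) :
    ∃ b : ℂ, φ = b • phiMinus ψ t t' := by
  obtain ⟨b, hb⟩ := h.exists_of_isDefect ψ hφ
  refine ⟨b, ψ.ext_repr fun n => mul_left_cancel₀ (ofReal_add_I_ne_zero (t n)) ?_⟩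
  rw [ψ.repr_smul_apply]
  have h1 := hb n
  rw [conj_I, sub_neg_eq_add] at h1
  linear_combination h1 - b * h.repr_phiMinus ψ n

end IsNormalizedBandlimitPair

/-! ### Eigenvalues of the extensions and phase functions -/

namespace IsNormalizedBandlimitPair

variable {F : Set ℤ} {t t' : F → ℝ} (h : IsNormalizedBandlimitPair F t t')
  {H : Type*} [NormedAddCommGroup H] [InnerProductSpace ℂ H] (ψ : HilbertBasis F ℂ H)

include h

/-- With v = y − Uy the eigenvalue equation is (s−i)y = (s+i)Uy. Writing y = (T+i)x + cφ₊ and Uy =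
(T−i)x + αcφ₋, multiplication by tₙ+i eliminates x coordinatewise, because (tₙ+i)(s−i) − (tₙ−i)(s+i)
= 2i(s−tₙ). -/
theorem isEigenvalueExt_iff_exists {φp φm : H} (hφ : IsDefectPair (symmOp ψ t t') φp φm)
    {a b : ℂ} (ha : φp = a • phiPlus ψ t t') (hb : φm = b • phiMinus ψ t t') (α : ℂ) (s : ℝ) :
    IsEigenvalueExt (symmOp ψ t t') φp φm α s ↔ ∃ y : H, y ≠ 0 ∧ ∀ n,
      2 * I * (t n - s) * ψ.repr y n
        = (s + I) * Real.sqrt (t' n) * ((a - α * b) * (inner ℂ φp y / (‖φp‖ : ℂ) ^ 2)) := by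
  have hnorm : (‖φp‖ : ℂ) ^ 2 ≠ 0 := by
    have := hφ.ne_zero
    exact pow_ne_zero 2 (by exact_mod_cast norm_ne_zero_iff.2 this)
  have ha0 : a ≠ 0 := by
    rintro rfl
    exact hφ.ne_zero (by rw [ha, zero_smul])
  have hself : inner ℂ φp φp = (‖φp‖ : ℂ) ^ 2 := inner_self_eq_norm_sq_to_K φp
  have hpn : ∀ n, ((t n : ℂ) - I) * ψ.repr φp n = a * Real.sqrt (t' n) := fun n => by
    rw [ha, ψ.repr_smul_apply, ← h.repr_phiPlus ψ n]; ring
  have hmn : ∀ n, ((t n : ℂ) + I) * ψ.repr φm n = b * Real.sqrt (t' n) := fun n => by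
    rw [hb, ψ.repr_smul_apply, ← h.repr_phiMinus ψ n]; ring
  constructor
  · rintro ⟨v, hv, y, u, ⟨v', ⟨x, d, hd, hy, hv'⟩, hu⟩, hvy, hsv⟩
    have hyu : ((s : ℂ) - I) • y = ((s : ℂ) + I) • u := by
      rw [hvy, smul_sub, smul_add] at hsv
      rw [sub_smul, add_smul]
      linear_combination (norm := module) hsv
    obtain ⟨c, hc⟩ : ∃ c : ℂ, d = c • φp := by
      obtain ⟨c, hc⟩ := h.eq_smul_phiPlus ψ hd
      refine ⟨c / a, ?_⟩
      rw [hc, ha, smul_smul, div_mul_cancel₀ _ ha0]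
    have hinner : inner ℂ φp y = c * (‖φp‖ : ℂ) ^ 2 := by
      rw [hy, inner_add_right, hc, inner_smul_right, hself]
      have := inner_phiPlus_symmOp ψ x
      rw [ha, inner_smul_left, this, mul_zero, zero_add]
    refine ⟨y, ?_, fun n => ?_⟩
    · rintro rfl
      rw [smul_zero, eq_comm, smul_eq_zero] at hyu
      rcases hyu with h0 | h0
      · exact ofReal_add_I_ne_zero s h0
      · exact hv (by rw [hvy, h0, sub_zero])
    · rw [hinner, mul_div_cancel_right₀ _ hnorm]
      have h1 := congrArg (fun w => ψ.repr w n) hyu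
      have h2 := congrArg (fun w => ψ.repr w n) hy
      have h3 := congrArg (fun w => ψ.repr w n) hu
      rw [hinner, hv'] at h3
      simp only [ψ.repr_smul_apply, ψ.repr_add_apply, ψ.repr_sub_apply, repr_symmOp, hc] at h1 h2 h3
      have h4 : α / (‖φp‖ : ℂ) ^ 2 * (c * (‖φp‖ : ℂ) ^ 2) = α * c := by
        rw [div_mul_eq_mul_div, ← mul_assoc, mul_div_cancel_right₀ _ hnorm]
      rw [h4] at h3
      linear_combination -((t n : ℂ) + I) * h1 + (s + I) * ((t n : ℂ) - I) * h2
        - (s + I) * ((t n : ℂ) + I) * h3 + (s + I) * c * hpn n - (s + I) * α * c * hmn n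
  · rintro ⟨y, hy0, hy⟩
    set c : ℂ := inner ℂ φp y / (‖φp‖ : ℂ) ^ 2 with hc
    -- Subtracting the projection onto φ₊ makes the right-hand side orthogonal to φ₊, so the
    -- preimage under T₀ + i lies in dom T.
    obtain ⟨x, hx⟩ := exists_resolvent ψ (t := t) (y - c • φp)
    have hTx : diagOp ψ t x + I • (x : H) = y - c • φp := by
      refine ψ.ext_repr fun n => ?_
      rw [ψ.repr_add_apply, ψ.repr_smul_apply, repr_diagOp, ← hx n]
      ring
    have horth : inner ℂ (phiPlus ψ t t') (y - c • φp) = 0 := by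
      have h1 : inner ℂ φp (y - c • φp) = 0 := by
        rw [inner_sub_right, inner_smul_right, hself, hc, div_mul_cancel₀ _ hnorm, sub_self]
      rw [ha, inner_smul_left, ← ha] at h1
      exact (mul_eq_zero.1 h1).resolve_left (by simpa using ha0)
    have hdom : (x : H) ∈ (symmOp ψ t t').domain :=
      (mem_symmOp_domain ψ).2 ⟨x.2, by rw [Subtype.coe_eta, hTx, horth]⟩
    have hTs : symmOp ψ t t' ⟨x, hdom⟩ = diagOp ψ t x := rfl
    have hdef : IsDefect (symmOp ψ t t') (-I) (c • φp) := fun x => by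
      rw [inner_smul_right, hφ.plus x, mul_zero]
    set u : H := (symmOp ψ t t' ⟨x, hdom⟩ - I • (x : H))
      + ((α / (‖φp‖ : ℂ) ^ 2) * inner ℂ φp y) • φm with hu
    have hyu : ((s : ℂ) - I) • y = ((s : ℂ) + I) • u := by
      refine ψ.ext_repr fun n => mul_left_cancel₀ (ofReal_add_I_ne_zero (t n)) ?_
      have h4 : α / (‖φp‖ : ℂ) ^ 2 * inner ℂ φp y = α * c := by rw [hc]; ring
      have h1 := hx n
      have h2 := hy n
      rw [hu, h4, hTs]
      simp only [ψ.repr_smul_apply, ψ.repr_add_apply, ψ.repr_sub_apply, repr_diagOp] at h1 ⊢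
      linear_combination -(s + I) * ((t n : ℂ) - I) * h1 - h2
        + (s + I) * c * hpn n - (s + I) * α * c * hmn n
    refine ⟨y - u, fun e => ?_, y, u, ⟨_, ⟨⟨x, hdom⟩, c • φp, hdef, ?_, rfl⟩, rfl⟩, rfl, ?_⟩
    · rw [← sub_eq_zero.1 e, ← sub_eq_zero, ← sub_smul, smul_eq_zero] at hyu
      rcases hyu with h0 | h0
      · have : (2 : ℂ) * I = 0 := by linear_combination -h0
        simp at this
      · exact hy0 h0
    · rw [hTs]
      change y = diagOp ψ t x + I • (x : H) + c • φp
      rw [hTx, sub_add_cancel]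
    · rw [sub_smul, add_smul] at hyu
      rw [smul_sub, smul_add]
      linear_combination (norm := module) hyu

/-- Off the tₙ, y must be a multiple of the kernel √t'ₙ/(tₙ−s); consistency with the coefficient
⟪φ₊, y⟫ gives 2ia = −(a−αb)(X−i), that is, αb(X−i) = a(X+i). At s = tₘ the condition is αb = a: then
ψₘ is a solution, while otherwise the coefficient vanishes and leaves no nonzero y. -/
theorem isEigenvalueExt_iff {φp φm : H} (hφ : IsDefectPair (symmOp ψ t t') φp φm)
    {a b : ℂ} (ha : φp = a • phiPlus ψ t t') (hb : φm = b • phiMinus ψ t t') (α : ℂ) (s : ℝ) :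
    IsEigenvalueExt (symmOp ψ t t') φp φm α s
      ↔ α * b = a * spectralCurve (bandMass t t') t s := by
  rw [h.isEigenvalueExt_iff_exists ψ hφ ha hb]
  have hP := h.isDiscreteProb
  have ha0 : a ≠ 0 := by
    rintro rfl
    exact hφ.ne_zero (by rw [ha, zero_smul])
  have hpi : (Real.pi : ℂ) ≠ 0 := by exact_mod_cast Real.pi_ne_zero
  have hsq : ∀ n, (Real.sqrt (t' n) : ℂ) ≠ 0 := fun n => by
    exact_mod_cast (Real.sqrt_pos.2 (h.pos n)).ne'
  have hcoef : ∀ y : H, a * (inner ℂ φp y / (‖φp‖ : ℂ) ^ 2)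
      = inner ℂ (phiPlus ψ t t') y / Real.pi := fun y => by
    have h1 : (‖φp‖ : ℂ) ^ 2 = a * (starRingEnd ℂ) a * Real.pi := by
      rw [ha, norm_smul, ofReal_mul, mul_pow, ← ofReal_pow ‖phiPlus ψ t t'‖,
        h.norm_phiPlus_sq ψ, Complex.mul_conj']
    rw [h1, ha, inner_smul_left]
    have : (starRingEnd ℂ) a ≠ 0 := by simpa using ha0
    field_simp
  by_cases hs : s ∈ Set.range t
  · obtain ⟨m, rfl⟩ := hs
    have hcurve : spectralCurve (bandMass t t') t (t m) = 1 := by simp [spectralCurve]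
    rw [hcurve, mul_one]
    constructor
    · rintro ⟨y, hy0, hy⟩
      by_contra hne
      have hm := hy m
      rw [sub_self, mul_zero, zero_mul, eq_comm] at hm
      have hc : inner ℂ φp y / (‖φp‖ : ℂ) ^ 2 = 0 := by
        rcases mul_eq_zero.1 hm with h1 | h1
        · exact absurd h1 (mul_ne_zero (ofReal_add_I_ne_zero _) (hsq m))
        · exact (mul_eq_zero.1 h1).resolve_left (sub_ne_zero.2 (Ne.symm hne))
      have hyn : ∀ n, n ≠ m → ψ.repr y n = 0 := fun n hn => by
        have h1 := hy n
        rw [hc, mul_zero, mul_zero] at h1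
        refine (mul_eq_zero.1 h1).resolve_left (mul_ne_zero (by simp) ?_)
        rw [sub_ne_zero]
        exact_mod_cast fun e => hn (hP.injective e)
      have hL : inner ℂ (phiPlus ψ t t') y = 0 := by
        have h1 := hcoef y
        rw [hc, mul_zero, eq_comm, div_eq_zero_iff] at h1
        exact h1.resolve_right hpi
      have hym : ψ.repr y m = 0 := by
        have h1 := (ψ.hasSum_conj_repr_mul_repr (phiPlus ψ t t') y).unique
          (hasSum_single m fun n hn => by rw [hyn n hn, mul_zero])
        rw [hL, eq_comm] at h1
        refine (mul_eq_zero.1 h1).resolve_left fun h2 => hsq m ?_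
        rw [← h.conj_repr_phiPlus ψ m, h2, mul_zero]
      refine hy0 (ψ.ext_repr fun n => ?_)
      rw [ψ.repr_zero_apply]
      by_cases e : n = m
      · rw [e, hym]
      · exact hyn n e
    · intro hα
      refine ⟨ψ m, fun e => ?_, fun n => ?_⟩
      · have := ψ.repr_self_apply_self m
        rw [e, ψ.repr_zero_apply] at this
        exact zero_ne_one this
      · rw [hα, sub_self, zero_mul, mul_zero]
        by_cases e : n = m
        · rw [e, sub_self, mul_zero, zero_mul]
        · rw [ψ.repr_self_apply_of_ne e, mul_zero]
  · obtain ⟨δ, hδ, hgap⟩ := hP.exists_gap hs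
    have hgap' : ∀ n, δ ≤ ‖(s : ℂ) - t n‖ := fun n => by
      rw [← ofReal_sub, Complex.norm_real, Real.norm_eq_abs]; exact hgap n
    set G := realCauchySum (bandMass t t') t s with hG
    have hinner : ∀ (y : H) (k : ℂ),
        (∀ n, ((t n : ℂ) - s) * ψ.repr y n = k * Real.sqrt (t' n)) →
        a * (inner ℂ φp y / (‖φp‖ : ℂ) ^ 2) = k * (1 - (s - I) * G) := fun y k hy => by
      have h1 := (h.inner_kernel ψ (z := s) (φ := y) (φ' := k) hδ hgap'
        (by simpa using hy)).1
      have h2 := congrArg (starRingEnd ℂ) h1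
      rw [inner_conj_symm, cauchySum_ofReal] at h2
      simp only [map_mul, map_sub, map_add, map_one, conj_conj, conj_ofReal, conj_I] at h2
      rw [hcoef y, h2]
      field_simp
      ring
    have hX : (nevanlinna (bandMass t t') t s : ℂ) = -s + (1 + (s : ℂ) ^ 2) * G := by
      simp [nevanlinna, hG]
    have hX' : ((s : ℂ) + I) * (1 - (s - I) * G) = -(nevanlinna (bandMass t t') t s - I) := by
      rw [hX]
      linear_combination (G : ℂ) * I_sq
    have hXne := ofReal_sub_I_ne_zero (nevanlinna (bandMass t t') t s)
    rw [spectralCurve, if_neg hs, ← mul_div_assoc, eq_div_iff hXne]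
    constructor
    · rintro ⟨y, hy0, hy⟩
      set c : ℂ := inner ℂ φp y / (‖φp‖ : ℂ) ^ 2 with hc
      have hc0 : c ≠ 0 := by
        intro e
        refine hy0 (ψ.ext_repr fun n => ?_)
        rw [ψ.repr_zero_apply]
        have h1 := hy n
        rw [e, mul_zero, mul_zero] at h1
        refine (mul_eq_zero.1 h1).resolve_left (mul_ne_zero (by simp) ?_)
        rw [sub_ne_zero]
        exact_mod_cast fun e => hs ⟨n, e⟩
      have h2 : (2 : ℂ) * I ≠ 0 := by simp
      have h1 := hinner y ((s + I) * ((a - α * b) * c) / (2 * I)) fun n => by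
        have h3 := hy n
        refine mul_left_cancel₀ h2 ?_
        rw [← mul_assoc, h3]
        field_simp
      have h3 : 2 * I * a = (s + I) * (a - α * b) * (1 - (s - I) * G) := by
        refine mul_right_cancel₀ hc0 ?_
        calc 2 * I * a * c = 2 * I * (a * c) := by ring
          _ = 2 * I * ((s + I) * ((a - α * b) * c) / (2 * I) * (1 - (s - I) * G)) := by rw [h1]
          _ = _ := by field_simp
      linear_combination -(a - α * b) * hX' - h3
    · intro hα
      obtain ⟨y, hy⟩ := h.exists_kernel ψ (z := s) hδ fun n => by
        rw [norm_sub_rev]; exact hgap' n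
      have h1 := hinner y 1 (by simpa using hy)
      refine ⟨y, ?_, fun n => ?_⟩
      · rintro rfl
        obtain ⟨m⟩ := hP.nonempty
        have := hy m
        rw [ψ.repr_zero_apply, mul_zero] at this
        exact hsq m this.symm
      · set c : ℂ := inner ℂ φp y / (‖φp‖ : ℂ) ^ 2 with hc
        have h2 : (s + I) * ((a - α * b) * c) = 2 * I := by
          refine mul_left_cancel₀ (mul_ne_zero ha0 hXne) ?_
          linear_combination (s + I) * (a - α * b) * (nevanlinna (bandMass t t') t s - I) * h1
            + (a - α * b) * (nevanlinna (bandMass t t') t s - I) * hX'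
            + (nevanlinna (bandMass t t') t s - I) * hα
        linear_combination 2 * I * hy n - (Real.sqrt (t' n)) * h2

theorem exists_spectralPhase {φp φm : H} (hφ : IsDefectPair (symmOp ψ t t') φp φm) :
    ∃ τ : ℝ → ℝ, IsPhaseFunctionOfOp (symmOp ψ t t') φp φm τ ∧
      ∀ σ : ℝ → ℝ, IsPhaseFunctionOfOp (symmOp ψ t t') φp φm σ →
        DifferentiableAt ℝ σ 0 ∧ 1 ≤ Real.pi * deriv σ 0 ∧
        (∀ m n : F, m ≠ n → 1 < Real.pi * deriv σ 0) ∧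
        ∀ m, t m = 0 → Real.pi * deriv σ 0 = 1 / bandMass t t' m := by
  obtain ⟨a, ha⟩ := h.eq_smul_phiPlus ψ hφ.plus
  obtain ⟨b, hb⟩ := h.eq_smul_phiMinus ψ hφ.minus
  have ha0 : a ≠ 0 := by
    rintro rfl
    exact hφ.ne_zero (by rw [ha, zero_smul])
  have hnorm : ‖a‖ = ‖b‖ := by
    have h1 := hφ.norm_eq
    rw [ha, hb, norm_smul, norm_smul, ← (h.isDefectPair ψ).norm_eq] at h1
    exact mul_right_cancel₀ (norm_ne_zero_iff.2 (h.isDefectPair ψ).ne_zero) h1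
  have hb0 : b ≠ 0 := by
    rw [← norm_ne_zero_iff, ← hnorm]
    exact norm_ne_zero_iff.2 ha0
  have hiff : ∀ (α : ℂ) (s : ℝ), IsEigenvalueExt (symmOp ψ t t') φp φm α s
      ↔ α = a / b * spectralCurve (bandMass t t') t s := fun α s => by
    rw [h.isEigenvalueExt_iff ψ hφ ha hb, div_mul_eq_mul_div, eq_div_iff hb0]
  obtain ⟨τ, hmono, hexp, hdiff, h1, h2, h3⟩ := h.isDiscreteProb.exists_spectralPhase
    (c := a / b) (by rw [norm_div, hnorm, div_self (norm_ne_zero_iff.2 hb0)])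
  have hcont : Continuous τ := Differentiable.continuous (𝕜 := ℝ) hdiff
  refine ⟨τ, ⟨hcont, hmono, fun θ s => ?_⟩, fun σ hσ => ?_⟩
  · rw [hiff, ← hexp, eq_comm, Complex.exp_eq_exp_iff_exists_int]
    refine exists_congr fun k => ?_
    have e : 2 * Real.pi * I * (θ : ℂ) + k * (2 * Real.pi * I)
        = 2 * Real.pi * I * ((θ + k : ℝ) : ℂ) := by push_cast; ring
    rw [e, mul_right_inj' Complex.two_pi_I_ne_zero, ofReal_inj]
  -- Taking θ = σ(s) shows that any phase function lifts the same curve, so it differs from τ by an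
  -- integer and shares its derivative.
  · obtain ⟨k, hk⟩ := exists_int_forall_eq_add_of_exp_eq hσ.continuous hcont fun s => by
      rw [hexp s, ← hiff]
      exact (hσ.eigenvalue_iff (σ s) s).2 ⟨0, by simp⟩
    have e : σ = fun s => τ s + k := funext hk
    rw [e, deriv_add_const]
    exact ⟨(hdiff 0).add_const _, h1, h2, h3⟩

theorem livsic_eq {z : ℂ} (hz : 0 < z.im) :
    livsic (symmOp ψ t t') (phiPlus ψ t t') (phiMinus ψ t t') z
      = (z - I) / (z + I) * ((1 - (z + I) * cauchySum (bandMass t t') t z)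
        / (1 - (z - I) * cauchySum (bandMass t t') t z)) := by
  have hgap : ∀ n, z.im ≤ ‖z - t n‖ := fun n => by
    have := Complex.abs_im_le_norm (z - t n)
    rw [sub_im, ofReal_im, sub_zero, abs_of_pos hz] at this
    exact this
  have hex : ∃ φ : H, IsDefect (symmOp ψ t t') z φ ∧ φ ≠ 0 := by
    obtain ⟨φ, hφ⟩ := h.exists_kernel ψ (z := (starRingEnd ℂ) z) hz fun n => by
      rw [← Complex.norm_conj, map_sub, conj_conj, conj_ofReal, norm_sub_rev]; exact hgap n
    refine ⟨φ, h.isDefect_of_forall ψ (c := 1) (by simpa using hφ), ?_⟩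
    rintro rfl
    obtain ⟨m⟩ := h.isDiscreteProb.nonempty
    have := hφ m
    rw [ψ.repr_zero_apply, mul_zero, eq_comm] at this
    exact (Real.sqrt_pos.2 (h.pos m)).ne' (by exact_mod_cast this)
  rw [livsic, dif_pos hex]
  -- The chosen defect vector is a nonzero multiple of the kernel vector, and the multiple cancels
  -- in the quotient.
  obtain ⟨hd, hne⟩ := hex.choose_spec
  obtain ⟨c, hc⟩ := h.exists_of_isDefect ψ hd
  have hc0 : c ≠ 0 := by
    rintro rfl
    refine hne (ψ.ext_repr fun n => ?_)
    rw [ψ.repr_zero_apply]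
    have h1 := hc n
    rw [zero_mul] at h1
    refine (mul_eq_zero.1 h1).resolve_left fun h2 => ?_
    have := congrArg Complex.im h2
    simp at this
    exact hz.ne' this
  obtain ⟨h1, h2⟩ := h.inner_kernel ψ hz hgap hc
  rw [h1, h2, mul_div_mul_left]
  refine mul_ne_zero (by simpa using hc0) (by exact_mod_cast Real.pi_ne_zero)

end IsNormalizedBandlimitPair

/-! ### The Paley-Wiener pair -/

/-- The terms 1/(x−n) are not absolutely summable, so only the symmetric pairs of f are prescribed.
Any summable f with these pair sums has the cotangent as its sum, whatever odd correction it
carries. -/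
theorem hasSum_int_cot {x : ℂ} (hx : x ∈ Complex.integerComplement) {f : ℤ → ℂ}
    (hf : Summable f) (h0 : f 0 = 1 / x)
    (h : ∀ n : ℕ, f (n + 1) + f (-(n + 1)) = 1 / (x - (n + 1)) + 1 / (x + (n + 1))) :
    HasSum f (Real.pi * cot (Real.pi * x)) := by
  have h1 := hf.hasSum.nat_add_neg
  have h2 : HasSum (fun n : ℕ => f ((n + 1 : ℕ) : ℤ) + f (-((n + 1 : ℕ) : ℤ)))
      (∑' n, f n - f 0) := by
    rw [hasSum_nat_add_iff (f := fun n : ℕ => f (n : ℤ) + f (-(n : ℤ))) 1]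
    rw [Finset.sum_range_one, Nat.cast_zero, neg_zero, ← add_assoc, sub_add_cancel]
    exact h1
  have h3 := cot_series_rep' hx
  have h4 : ∑' n, f n = Real.pi * cot (Real.pi * x) := by
    rw [← h0, ← tsum_congr h] at h3
    have h5 := h2.tsum_eq
    push_cast at h5
    rw [h5] at h3
    linear_combination -h3
  rw [← h4]
  exact hf.hasSum

theorem mem_integerComplement_of_im_ne_zero {x : ℂ} (hx : x.im ≠ 0) :
    x ∈ Complex.integerComplement := by
  rintro ⟨n, rfl⟩
  simp at hx

theorem strictMono_pwT {A : ℝ} (hA : 0 < A) : StrictMono (pwT A) := by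
  intro m n hmn
  have h1 : ((m : ℤ) : ℝ) < ((n : ℤ) : ℝ) := by exact_mod_cast hmn
  unfold pwT
  have := Real.pi_pos
  gcongr

theorem not_accPt_range_pwT {A : ℝ} (hA : 0 < A) (x : ℝ) :
    ¬ AccPt x (𝓟 (Set.range (pwT A))) := by
  have hc : 0 < Real.pi / A := by have := Real.pi_pos; positivity
  have hfin : (Set.range (pwT A) ∩ Metric.closedBall x 1).Finite := by
    have h1 : (((↑) : ℤ → ℝ) ⁻¹' Metric.closedBall (x / (Real.pi / A))
        (1 / (Real.pi / A))).Finite := by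
      have := Int.tendsto_coe_cofinite (isCompact_closedBall (x / (Real.pi / A))
        (1 / (Real.pi / A))).compl_mem_cocompact
      rwa [mem_map, mem_cofinite, Set.preimage_compl, compl_compl] at this
    refine (h1.image fun n : ℤ => (n : ℝ) * Real.pi / A).subset ?_
    rintro _ ⟨⟨n, rfl⟩, hn⟩
    refine ⟨n, ?_, rfl⟩
    rw [Metric.mem_closedBall, Real.dist_eq] at hn
    rw [Set.mem_preimage, Metric.mem_closedBall, Real.dist_eq, le_div_iff₀ hc]
    rw [← abs_of_pos hc, ← abs_mul, abs_of_pos hc, sub_mul, div_mul_cancel₀ _ hc.ne',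
      ← mul_div_assoc]
    exact hn
  rw [accPt_iff_frequently_nhdsNE, not_frequently, eventually_nhdsWithin_iff]
  have hfin2 : ((Set.range (pwT A) ∩ Metric.closedBall x 1) \ {x}).Finite := hfin.sdiff
  filter_upwards [hfin2.isClosed.isOpen_compl.mem_nhds (by simp :
    x ∈ ((Set.range (pwT A) ∩ Metric.closedBall x 1) \ {x})ᶜ),
    Metric.closedBall_mem_nhds x one_pos] with y hy hyb hyx hyr
  exact hy ⟨⟨hyr, hyb⟩, hyx⟩

theorem tanh_eq_ratio (A : ℝ) :
    Real.tanh A = (1 - Real.exp (-2 * A)) / (1 + Real.exp (-2 * A)) := by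
  rw [Real.tanh_eq]
  have h1 : Real.exp (-2 * A) = Real.exp (-A) * Real.exp (-A) := by
    rw [← Real.exp_add]; ring_nf
  have h2 : Real.exp A * Real.exp (-A) = 1 := by rw [← Real.exp_add]; simp
  have h3 := Real.exp_pos A
  have h4 := Real.exp_pos (-A)
  rw [h1, div_eq_div_iff (by positivity) (by positivity)]
  linear_combination (2 * Real.exp (-A)) * h2

theorem tanh_pos {A : ℝ} (hA : 0 < A) : 0 < Real.tanh A := by
  rw [Real.tanh_eq_sinh_div_cosh]
  exact div_pos (Real.sinh_pos_iff.2 hA) (Real.cosh_pos A)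

theorem isNormalizedBandlimitPair_pw {A : ℝ} (hA : 0 < A) :
    IsNormalizedBandlimitPair Set.univ (pwT A) (pwT' A) := by
  have hpi := Real.pi_pos
  have hpiC : (Real.pi : ℂ) ≠ 0 := by exact_mod_cast hpi.ne'
  have hAC : (A : ℂ) ≠ 0 := by exact_mod_cast hA.ne'
  have hT := tanh_pos hA
  -- At this point π cot(πx) = −iπ coth A, and multiplication by i tanh A yields the required sum π.
  set x : ℂ := I * A / Real.pi with hx
  have hxim : x ∈ Complex.integerComplement := mem_integerComplement_of_im_ne_zero (by
    have : x = ((A / Real.pi : ℝ) : ℂ) * I := by rw [hx]; push_cast; ring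
    rw [this, Complex.im_ofReal_mul, I_im, mul_one]
    positivity)
  have hx0 : x ≠ 0 := by rw [hx]; exact div_ne_zero (mul_ne_zero I_ne_zero hAC) hpiC
  have hsub : ∀ n : ℤ, x - n ≠ 0 := fun n e => hxim ⟨n, (sub_eq_zero.1 e).symm⟩
  have hadd : ∀ n : ℤ, x + n ≠ 0 := fun n e =>
    hxim ⟨-n, by push_cast; linear_combination -e⟩
  set f : ℤ → ℂ := fun n => x * ((x - n) * (x + n))⁻¹ with hf
  have hfs : Summable f := by
    have := (EisensteinSeries.summable_linear_sub_mul_linear_add x 1 1).mul_left x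
    exact this.congr fun n => by simp only [hf, Int.cast_one, one_mul]
  have h1 := hasSum_int_cot hxim hfs
    (by simp only [hf, Int.cast_zero, sub_zero, add_zero]; field_simp)
    (fun n => by
      have e1 := hsub (n + 1)
      have e2 := hadd (n + 1)
      push_cast at e1 e2
      simp only [hf]
      push_cast
      rw [sub_neg_eq_add, ← sub_eq_add_neg x]
      field_simp
      ring)
  have hcot : I * Real.tanh A * (Real.pi * cot (Real.pi * x)) = Real.pi := by
    have e1 : 2 * I * (Real.pi * x) = ((-2 * A : ℝ) : ℂ) := by
      rw [hx, mul_div_cancel₀ _ hpiC]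
      push_cast
      linear_combination 2 * (A : ℂ) * I_sq
    have hlt : Real.exp (-2 * A) < 1 := by
      rw [Real.exp_lt_one_iff]; linarith
    have hpos := Real.exp_pos (-2 * A)
    rw [Complex.cot_eq_exp_ratio, e1, ← Complex.ofReal_exp, tanh_eq_ratio]
    generalize Real.exp (-2 * A) = ρ at hlt hpos
    have hne1 : (1 - ρ : ℂ) ≠ 0 := by
      exact_mod_cast (by linarith : (1 - ρ : ℝ) ≠ 0)
    have hne2 : (1 + ρ : ℂ) ≠ 0 := by
      exact_mod_cast (by positivity : (1 + ρ : ℝ) ≠ 0)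
    push_cast
    have hI := I_ne_zero
    field_simp
    ring
  have h2 := h1.mul_left (I * Real.tanh A)
  rw [hcot, ← (Equiv.Set.univ ℤ).hasSum_iff] at h2
  have h3 : HasSum (fun n => pwT' A n / (1 + pwT A n ^ 2)) Real.pi := by
    rw [← Complex.hasSum_ofReal]
    refine h2.congr_fun fun n => ?_
    simp only [Function.comp, Equiv.Set.univ_apply, pwT, pwT', hf]
    have e1 : (x - ((n : ℤ) : ℂ)) * (x + ((n : ℤ) : ℂ))
        = -((A ^ 2 + ((n : ℤ) : ℂ) ^ 2 * Real.pi ^ 2) / Real.pi ^ 2) := by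
      rw [hx]
      field_simp
      linear_combination (A : ℂ) ^ 2 * I_sq
    have e2 : (A : ℂ) ^ 2 + ((n : ℤ) : ℂ) ^ 2 * Real.pi ^ 2 ≠ 0 := by
      have : (A ^ 2 + ((n : ℤ) : ℝ) ^ 2 * Real.pi ^ 2) ≠ 0 := by positivity
      exact_mod_cast this
    have e3 : (1 : ℂ) + (((n : ℤ) : ℂ) * Real.pi / A) ^ 2
        = (A ^ 2 + ((n : ℤ) : ℂ) ^ 2 * Real.pi ^ 2) / A ^ 2 := by
      field_simp
    rw [e1, hx]
    push_cast
    rw [e3]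
    generalize (A : ℂ) ^ 2 + ((n : ℤ) : ℂ) ^ 2 * Real.pi ^ 2 = D at e2
    field_simp
    linear_combination Complex.tanh A * I_sq
  exact
    { index := Or.inr (Or.inr (Or.inl rfl))
      strictMono := strictMono_pwT hA
      noAcc := not_accPt_range_pwT hA
      pos := fun n => mul_pos (by positivity) hT
      compatible := h3.summable
      normalized := h3 }

theorem nevanlinna_pw {A : ℝ} (hA : 0 < A) {z : ℂ} (hz : 0 < z.im) :
    -z + (1 + z ^ 2) * cauchySum (bandMass (pwT A) (pwT' A)) (pwT A) z
      = Real.tanh A * cot (A * z) := by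
  have h := (isNormalizedBandlimitPair_pw hA).isDiscreteProb
  have hpiC : (Real.pi : ℂ) ≠ 0 := by exact_mod_cast Real.pi_ne_zero
  have hAC : (A : ℂ) ≠ 0 := by exact_mod_cast hA.ne'
  have hTC : (Real.tanh A : ℂ) ≠ 0 := by exact_mod_cast (tanh_pos hA).ne'
  set x : ℂ := A * z / Real.pi with hx
  have hxim : x ∈ Complex.integerComplement := mem_integerComplement_of_im_ne_zero (by
    have : x = ((A / Real.pi : ℝ) : ℂ) * z := by rw [hx]; push_cast; ring
    rw [this, Complex.im_ofReal_mul]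
    have := Real.pi_pos
    positivity)
  have hsub : ∀ n : ℤ, x - n ≠ 0 := fun n e => hxim ⟨n, (sub_eq_zero.1 e).symm⟩
  have hden : ∀ n : ℤ, (A : ℂ) ^ 2 + (n : ℂ) ^ 2 * Real.pi ^ 2 ≠ 0 := fun n => by
    have : (A ^ 2 + (n : ℝ) ^ 2 * Real.pi ^ 2) ≠ 0 := by positivity
    exact_mod_cast this
  -- The second term is the convergence factor u/(1+u²), u = nπ/A, from the partial fractions of −z
  -- + (1+z²)/(z−u) over 1+u². It is odd in n and drops out of symmetric pairs.
  set f : ℤ → ℂ := fun n => 1 / (x - n) + n * Real.pi ^ 2 / (A ^ 2 + (n : ℂ) ^ 2 * Real.pi ^ 2)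
    with hf
  have h1 : HasSum (fun n => (bandMass (pwT A) (pwT' A) n : ℂ)) 1 := by
    simpa using Complex.hasSum_ofReal.2 h.hasSum
  have h2 := (summable_div_of_le (c := fun n => z - pwT A n) h.hasSum.summable
    (fun n => (h.pos n).le) hz fun n _ => by
      have := Complex.abs_im_le_norm (z - pwT A n)
      rwa [sub_im, ofReal_im, sub_zero, abs_of_pos hz] at this).hasSum
  have h3 := (h1.mul_left (-z)).add (h2.mul_left (1 + z ^ 2))
  have h4 : HasSum (fun n : (Set.univ : Set ℤ) => Real.tanh A / Real.pi * f n)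
      (-z * 1 + (1 + z ^ 2) * cauchySum (bandMass (pwT A) (pwT' A)) (pwT A) z) := by
    refine h3.congr_fun fun n => ?_
    have e1 := hsub n
    have e2 := hden n
    have e3 : (1 : ℂ) + (((n : ℤ) : ℂ) * Real.pi / A) ^ 2
        = (A ^ 2 + ((n : ℤ) : ℂ) ^ 2 * Real.pi ^ 2) / A ^ 2 := by
      field_simp
    have e4 : z = Real.pi * x / A := by rw [hx]; field_simp
    have e5 : z - ((n : ℤ) : ℂ) * Real.pi / A = Real.pi * (x - (n : ℤ)) / A := by
      rw [e4]; ring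
    have e6 : ∀ u : ℂ, 1 + u ^ 2 ≠ 0 → z - u ≠ 0 →
        (-z + (1 + z ^ 2) / (z - u)) / (1 + u ^ 2) = 1 / (z - u) + u / (1 + u ^ 2) := by
      intro u hu hzu
      field_simp
      ring
    have e7 := e6 (((n : ℤ) : ℂ) * Real.pi / A)
      (by rw [e3]; exact div_ne_zero e2 (pow_ne_zero 2 hAC))
      (by rw [e5]; exact div_ne_zero (mul_ne_zero hpiC e1) hAC)
    simp only [hf, bandMass, pwT, pwT']
    push_cast
    calc _ = Complex.tanh A / A * ((-z + (1 + z ^ 2) / (z - ((n : ℤ) : ℂ) * Real.pi / A))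
          / (1 + (((n : ℤ) : ℂ) * Real.pi / A) ^ 2)) := by
          rw [e7, e5, e3]
          generalize (A : ℂ) ^ 2 + ((n : ℤ) : ℂ) ^ 2 * Real.pi ^ 2 = D at e2
          field_simp
      _ = _ := by
        field_simp
  have h5 : HasSum (fun n => Real.tanh A / Real.pi * f n)
      (-z * 1 + (1 + z ^ 2) * cauchySum (bandMass (pwT A) (pwT' A)) (pwT A) z) := by
    rw [← (Equiv.Set.univ ℤ).hasSum_iff]
    exact h4
  have hTpi : (Real.tanh A / Real.pi : ℂ) ≠ 0 := div_ne_zero hTC hpiC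
  have hfs : Summable f := (summable_mul_left_iff hTpi).1 h5.summable
  have h6 := hasSum_int_cot hxim hfs (by simp [hf]) fun n => by
    simp only [hf]
    push_cast
    rw [neg_sq, sub_neg_eq_add]
    ring
  have h7 := h5.unique (h6.mul_left (Real.tanh A / Real.pi : ℂ))
  have h8 : (Real.pi : ℂ) * x = A * z := by rw [hx]; field_simp
  rw [h8] at h7
  rw [mul_one] at h7
  rw [h7]
  field_simp

theorem bandParam_pw {A : ℝ} (hA : 0 < A) {τ : ℝ → ℝ}
    (hτ : Real.pi * deriv τ 0 = A / Real.tanh A) :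
    bandParam τ = Real.exp (-2 * A) := by
  have hT := tanh_pos hA
  have h1 : A / Real.tanh A = xCoth A := by
    rw [xCoth_of_pos hA, Real.tanh_eq_sinh_div_cosh, div_div_eq_mul_div, mul_div_assoc]
  rw [bandParam, hτ]
  -- Only the arguments of `xCothInv` are rewritten; the first rewrite removes one occurrence, so
  -- the second argument is then the third.
  nth_rewrite 2 [h1]
  nth_rewrite 3 [h1]
  rw [xCothInv_xCoth hA.le]
  have h2 : (A / Real.tanh A - A) / (A / Real.tanh A + A)
      = (1 - Real.tanh A) / (1 + Real.tanh A) := by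
    field_simp
  have h3 := Real.exp_pos (-2 * A)
  rw [h2, div_eq_iff (by positivity), tanh_eq_ratio]
  field_simp
  ring

/-- Θ_T is F_ρ applied to exp(2iAz), and F_{−ρ} is the inverse of F_ρ. The denominators do not
vanish because |exp(2iAz)| < 1 and 0 < ρ < 1. -/
theorem moebius_livsic_pw {A : ℝ} (hA : 0 < A) {H : Type*} [NormedAddCommGroup H]
    [InnerProductSpace ℂ H] (ψ : HilbertBasis (Set.univ : Set ℤ) ℂ H) {z : ℂ} (hz : 0 < z.im) :
    moebius (-(Real.exp (-2 * A) : ℂ)) (livsic (symmOp ψ (pwT A) (pwT' A))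
      (phiPlus ψ (pwT A) (pwT' A)) (phiMinus ψ (pwT A) (pwT' A)) z) = exp (2 * I * (A * z)) := by
  have hX := nevanlinna_pw hA hz
  rw [(isNormalizedBandlimitPair_pw hA).livsic_eq ψ hz]
  set G := cauchySum (bandMass (pwT A) (pwT' A)) (pwT A) z
  set E : ℂ := exp (2 * I * (A * z)) with hE
  set ρ : ℝ := Real.exp (-2 * A) with hρ
  have hρ0 : 0 < ρ := Real.exp_pos _
  have hρ1 : ρ < 1 := by rw [hρ, Real.exp_lt_one_iff]; linarith
  have hEn : ‖E‖ < 1 := by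
    rw [hE, Complex.norm_exp, Real.exp_lt_one_iff]
    have : (2 * I * (A * z)).re = -(2 * A * z.im) := by simp; ring
    rw [this, neg_lt_zero]
    positivity
  have hE1 : 1 - E ≠ 0 := fun e => by
    rw [← sub_eq_zero.1 e, norm_one] at hEn
    exact lt_irrefl _ hEn
  have hρE : 1 - ρ * E ≠ 0 := fun e => by
    have h1 : ‖(ρ : ℂ) * E‖ = 1 := by rw [← sub_eq_zero.1 e, norm_one]
    rw [norm_mul, Complex.norm_real, Real.norm_of_nonneg hρ0.le] at h1
    nlinarith [norm_nonneg E]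
  have hρp : (1 : ℂ) + ρ ≠ 0 := by
    exact_mod_cast (by positivity : (1 + ρ : ℝ) ≠ 0)
  have hρρ : (1 : ℂ) - ρ ^ 2 ≠ 0 := by
    exact_mod_cast (by nlinarith : (1 - ρ ^ 2 : ℝ) ≠ 0)
  have hL : (z - I) / (z + I) * ((1 - (z + I) * G) / (1 - (z - I) * G))
      = (E - ρ) / (1 - ρ * E) := by
    rw [div_mul_div_comm]
    have e1 : (z - I) * (1 - (z + I) * G) = -((-z + (1 + z ^ 2) * G) + I) := by
      linear_combination G * I_sq
    have e2 : (z + I) * (1 - (z - I) * G) = -((-z + (1 + z ^ 2) * G) - I) := by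
      linear_combination G * I_sq
    have e3 : (Real.tanh A : ℂ) * cot (A * z) = (1 - ρ) / (1 + ρ) * ((E + 1) / (I * (1 - E))) := by
      rw [tanh_eq_ratio, Complex.cot_eq_exp_ratio]
      rw [← hρ, ← hE, ofReal_div, ofReal_sub, ofReal_add, ofReal_one]
    have e4 : (Real.tanh A : ℂ) * cot (A * z) + I
        = 2 * (E - ρ) / ((1 + ρ) * (I * (1 - E))) := by
      rw [e3]
      field_simp
      linear_combination (1 + (ρ : ℂ)) * (1 - E) * I_sq
    have e5 : (Real.tanh A : ℂ) * cot (A * z) - I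
        = 2 * (1 - ρ * E) / ((1 + ρ) * (I * (1 - E))) := by
      rw [e3]
      field_simp
      linear_combination -(1 + (ρ : ℂ)) * (1 - E) * I_sq
    have hD : (1 + (ρ : ℂ)) * (I * (1 - E)) ≠ 0 := mul_ne_zero hρp (mul_ne_zero I_ne_zero hE1)
    rw [e1, e2, neg_div_neg_eq, hX, e4, e5, div_div_div_cancel_right₀ hD,
      mul_div_mul_left _ _ two_ne_zero]
  have e1 : (E - ρ) / (1 - ρ * E) - -(ρ : ℂ) = E * ((1 - ρ ^ 2) / (1 - ρ * E)) := by
    rw [sub_neg_eq_add, div_add' _ _ _ hρE, ← mul_div_assoc]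
    congr 1
    ring
  have e2 : 1 - (E - ρ) / (1 - ρ * E) * -(ρ : ℂ) = (1 - ρ ^ 2) / (1 - ρ * E) := by
    rw [mul_neg, sub_neg_eq_add, div_mul_eq_mul_div, add_div' _ _ _ hρE]
    congr 1
    ring
  rw [hL, moebius, map_neg, conj_ofReal, e1, e2, mul_div_cancel_right₀ _ (div_ne_zero hρρ hρE)]

theorem isTimeVaryingBandlimit_pw_iff {A : ℝ} (hA : 0 < A) {H : Type*} [NormedAddCommGroup H]
    [InnerProductSpace ℂ H] (ψ : HilbertBasis (Set.univ : Set ℤ) ℂ H) (ω : ℝ → ℝ) :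
    IsTimeVaryingBandlimit (symmOp ψ (pwT A) (pwT' A))
      (phiPlus ψ (pwT A) (pwT' A)) (phiMinus ψ (pwT A) (pwT' A)) ω ↔ ω = fun _ => A := by
  have h := isNormalizedBandlimitPair_pw hA
  have hpi := Real.pi_pos
  obtain ⟨τ₀, hτ₀, hphase⟩ := h.exists_spectralPhase ψ (h.isDefectPair ψ)
  have hw : ∀ τ, IsPhaseFunctionOfOp (symmOp ψ (pwT A) (pwT' A)) (phiPlus ψ (pwT A) (pwT' A))
      (phiMinus ψ (pwT A) (pwT' A)) τ → bandParam τ = Real.exp (-2 * A) := fun τ hτ => by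
    -- As t₀ = 0, πτ'(0) = 1/μ₀ = A coth A for every phase function τ, so w does not depend on the
    -- choice.
    have h1 := (hphase τ hτ).2.2.2 ⟨0, Set.mem_univ _⟩ (by simp [pwT])
    refine bandParam_pw hA (h1.trans ?_)
    have := (tanh_pos hA).ne'
    simp only [bandMass, pwT, pwT', Int.cast_zero]
    field_simp
    simp
  have hlim : ∀ s : ℝ, Tendsto (fun z : ℂ => exp (2 * I * (A * z)))
      (𝓝[{z : ℂ | 0 < z.im}] (s : ℂ)) (𝓝 (exp (2 * Real.pi * I * (A * s / Real.pi : ℝ)))) := by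
    intro s
    have hc : Continuous fun z : ℂ => exp (2 * I * (A * z)) := by fun_prop
    have e : 2 * Real.pi * I * ((A * s / Real.pi : ℝ) : ℂ) = 2 * I * (A * s) := by
      have : (Real.pi : ℂ) ≠ 0 := by exact_mod_cast hpi.ne'
      push_cast
      field_simp
    rw [e]
    exact (hc.tendsto (s : ℂ)).mono_left nhdsWithin_le_nhds
  have hderiv : ∀ s : ℝ, HasDerivAt (fun s : ℝ => A * s / Real.pi) (A / Real.pi) s := fun s => by
    simpa using ((hasDerivAt_id s).const_mul A).div_const Real.pi
  have hΦ : ∀ s : ℝ, ∀ τ, bandParam τ = Real.exp (-2 * A) →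
      (fun z => moebius (-(bandParam τ : ℂ)) (livsic (symmOp ψ (pwT A) (pwT' A))
        (phiPlus ψ (pwT A) (pwT' A)) (phiMinus ψ (pwT A) (pwT' A)) z))
      =ᶠ[𝓝[{z : ℂ | 0 < z.im}] (s : ℂ)] fun z : ℂ => exp (2 * I * (A * z)) := by
    intro s τ hτ
    filter_upwards [self_mem_nhdsWithin] with z hz
    rw [hτ]
    exact moebius_livsic_pw hA ψ hz
  constructor
  · rintro ⟨τ, γ, hτ, hγ, hω⟩
    -- Real points lie in the closure of the half-plane, so boundary limits are unique and determine
    -- γ up to an integer.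
    have hne : ∀ s : ℝ, (𝓝[{z : ℂ | 0 < z.im}] (s : ℂ)).NeBot := fun s => by
      rw [← mem_closure_iff_nhdsWithin_neBot, Complex.closure_setOfPred_lt_im]
      simp
    have hexp : ∀ s : ℝ, exp (2 * Real.pi * I * γ s)
        = exp (2 * Real.pi * I * (A * s / Real.pi : ℝ)) := fun s =>
      haveI := hne s
      tendsto_nhds_unique ((hγ.boundary s).congr' (hΦ s τ (hw τ hτ))) (hlim s)
    obtain ⟨k, hk⟩ := exists_int_forall_eq_add_of_exp_eq
      hγ.analytic.continuous (g := fun s => A * s / Real.pi) (by fun_prop) hexp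
    funext s
    rw [hω s, funext hk, deriv_add_const, (hderiv s).deriv]
    field_simp
  · rintro rfl
    refine ⟨τ₀, fun s => A * s / Real.pi, hτ₀, ?_, fun s => ?_⟩
    · exact
        { strictMono := strictMono_of_deriv_pos fun s => by rw [(hderiv s).deriv]; positivity
          analytic := fun s _ => (analyticAt_const.mul analyticAt_id).div_const
          deriv_pos := fun s => by rw [(hderiv s).deriv]; positivity
          boundary := fun s => (hlim s).congr' (hΦ s τ₀ (hw τ₀ hτ₀)).symm
          init := by simp }
    · rw [(hderiv s).deriv]
      field_simp

end
theorem mainTheorem11 :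
    -- the Paley-Wiener pair is a normalized bandlimit pair, and its bandlimit is the constant `A`
    (∀ A : ℝ, 0 < A →
      IsNormalizedBandlimitPair Set.univ (pwT A) (pwT' A) ∧
      ∀ {H : Type*} [NormedAddCommGroup H] [InnerProductSpace ℂ H] [CompleteSpace H]
        (ψ : HilbertBasis (Set.univ : Set ℤ) ℂ H) (ω : ℝ → ℝ),
        IsTimeVaryingBandlimit (symmOp ψ (pwT A) (pwT' A))
          (phiPlus ψ (pwT A) (pwT' A)) (phiMinus ψ (pwT A) (pwT' A)) ω ↔
        ω = fun _ => A) ∧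
    -- the function `g` is a bijection of `[0, ∞)` onto `[1, ∞)`
    Set.BijOn xCoth (Set.Ici 0) (Set.Ici 1) ∧
    -- the parameter `w` is well defined, and it lies in `[0, 1)`
    (∀ (F : Set ℤ) (t t' : F → ℝ), IsNormalizedBandlimitPair F t t' →
      ∀ {H : Type*} [NormedAddCommGroup H] [InnerProductSpace ℂ H] [CompleteSpace H]
        (ψ : HilbertBasis F ℂ H),
        IsDefectPair (symmOp ψ t t') (phiPlus ψ t t') (phiMinus ψ t t') ∧
        ∀ φp φm : H, IsDefectPair (symmOp ψ t t') φp φm →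
          (∃ τ : ℝ → ℝ, IsPhaseFunctionOfOp (symmOp ψ t t') φp φm τ) ∧
          ∀ τ : ℝ → ℝ, IsPhaseFunctionOfOp (symmOp ψ t t') φp φm τ →
            DifferentiableAt ℝ τ 0 ∧
            1 ≤ Real.pi * deriv τ 0 ∧
            (F.Nontrivial → bandParam τ ∈ Set.Ico (0 : ℝ) 1)) := by
  refine ⟨fun A hA => ⟨isNormalizedBandlimitPair_pw hA, fun ψ ω =>
    isTimeVaryingBandlimit_pw_iff hA ψ ω⟩, bijOn_xCoth, fun F t t' h H _ _ _ ψ =>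
    ⟨h.isDefectPair ψ, fun φp φm hφ => ?_⟩⟩
  obtain ⟨τ₀, hτ₀, hphase⟩ := h.exists_spectralPhase ψ hφ
  refine ⟨⟨τ₀, hτ₀⟩, fun τ hτ => ?_⟩
  obtain ⟨h1, h2, h3, -⟩ := hphase τ hτ
  refine ⟨h1, h2, ?_⟩
  rintro ⟨m, hm, n, hn, hmn⟩
  exact bandParam_mem_Ico (h3 ⟨m, hm⟩ ⟨n, hn⟩ fun e => hmn (congrArg Subtype.val e))
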